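/- Let $n>2$ and let $L=\sum_{k=1}^{n}a_k(x)D^k$, where $D=d/dx$, each $a_k$ is a real polynomial with $\deg a_k\le k$, and $a_n\neq 0$. Suppose that $L$ is self-adjoint in the following sense: there are a nonempty open interval $I\subseteq\mathbb{R}$ (bounded or unbounded) containing no zero of $a_n$, and a weight $p\ge 0$ on $I$ that is smooth off a finite set $F$, positive at some point of $I\setminus F$, and such that $pq$ is integrable over $I$ for every polynomial $q$, with $$\int_I p\,(Lu)\,v\,dx=\int_I p\,u\,(Lv)\,dx$$ for all $u,v:\mathbb{R}\to\mathbb{R}$ each of which is a polynomial or a compactly supported $C^\infty$ function. Write $a=a_n$ and $b=a_{n-1}$, and suppose that $a$ has at most one real root (not counting multiplicity). Then $$2\deg b-\deg a\le n-2\quad\text{or}\quad 3\deg b-2\deg a\le n-3.$$ (i) If $a$ has no real root, then $\deg a<\deg b\le n-3$. (ii) Suppose $a$ has exactly one real root $r$, of multiplicity $\alpha$ in $a$, let $\beta\ge 0$ be the multiplicity of $r$ as a root of $b$ (with $\beta=0$ if $b(r)\ne0$), and let $a=(x-r)^{\alpha}u$, $b=(x-r)^{\beta}v$ with polynomials $u,v$.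 Then $$2\le\deg a\le\deg b\le n-2\quad\text{and}\quad 1+\deg u\le\deg v\le n-3.$$ -/

import Mathlib

open MeasureTheory Polynomial
open scoped ContDiff

/-- The differential operator `L u = ∑_{k=1}^n a_k u^{(k)}` acting on functions. -/
noncomputable def diffOp (n : ℕ) (a : ℕ → ℝ[X]) (u : ℝ → ℝ) (x : ℝ) : ℝ :=
  ∑ k ∈ Finset.Icc 1 n, (a k).eval x * iteratedDeriv k u x

/-- Smooth functions whose products are integrable against every admissible weight:
polynomials and compactly supported smooth functions. -/
def IsTestFunction (u : ℝ → ℝ) : Prop :=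
  (∃ q : ℝ[X], u = fun x => q.eval x) ∨ (ContDiff ℝ ∞ u ∧ HasCompactSupport u)

/-- `p` is an admissible weight on `I`: it is nonnegative, not (essentially) zero, smooth off
finitely many points, and `p q` is integrable on `I` for every polynomial `q`. -/
structure IsAdmissibleWeight (I : Set ℝ) (p : ℝ → ℝ) : Prop where
  nonneg : ∀ x ∈ I, 0 ≤ p x
  piecewise_smooth : ∃ F : Set ℝ, F.Finite ∧ ContDiffOn ℝ ∞ p (I \ F) ∧ ∃ x ∈ I \ F, 0 < p x
  integrable : ∀ q : ℝ[X], IntegrableOn (fun x => p x * q.eval x) I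

/-- `L = ∑_{k=1}^n a_k D^k` is an operator of order exactly `n`, with `deg a_k ≤ k`, which is
self-adjoint for the inner product `⟨u, v⟩ = ∫_I p u v` of some admissible weight `p` on some
nonempty open interval `I` (bounded or not) that contains no zero of the leading coefficient. -/
def IsSelfAdjointDiffOp (n : ℕ) (a : ℕ → ℝ[X]) : Prop :=
  a n ≠ 0 ∧ (∀ k ∈ Finset.Icc 1 n, (a k).natDegree ≤ k) ∧
    ∃ (I : Set ℝ) (p : ℝ → ℝ),
      IsOpen I ∧ I.OrdConnected ∧ I.Nonempty ∧ (∀ x ∈ I, (a n).eval x ≠ 0) ∧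
      IsAdmissibleWeight I p ∧
      ∀ u v : ℝ → ℝ, IsTestFunction u → IsTestFunction v →
        ∫ x in I, p x * diffOp n a u x * v x = ∫ x in I, p x * u x * diffOp n a v x

/-! Write c = a_{n-2}, d = a_{n-3}. Multiplication by x is symmetric for ∫ p u v, so commuting with
x turns a symmetric operator into an antisymmetric one and conversely. After m commutators, divided
by m!, L becomes ∑ C(k+m, m) a_{k+m} D^k, with sign (-1)^m. For m = n this is multiplication by a,
which forces n to be even, hence n ≥ 4. For m = n-1 and m = n-3, pairing with 1 gives weak forms of
n(pa)' = 2bp and of (pγ)' = 2dp/(n-2), where pγ = cp - ((n-1)/6)(bp)'. Positivity of p eliminates p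
and leaves a polynomial identity for Q = aγ (`IsFluxRelation`). Its top coefficient yields the
degree dichotomy. At a multiple root r of a it forces b(r) = 0; at a simple root with b(r) ≠ 0 it
allows p only the exponents 0 and 1.

Test functions need not vanish at the ends of I, so p extended by zero solves both equations weakly
on all of ℝ; this encodes the boundary conditions. By du Bois-Reymond, pa is a constant multiple of
a positive solution of M' = (2b/(na))M on every interval where b/a is regular. Finite moments force
deg a ≤ deg b, strictly when a has no root, since both infinities then impose conditions of opposite
sign. If r is the only root, p vanishes on one side of it. Were b/a regular at r, M would continue
across r and p would vanish everywhere; hence β < α. A simple root with b(r) ≠ 0 is impossible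
because a one-sided p of exponent 0 or 1 leaves a nonzero boundary term in the third order equation;
hence β ≥ 1. The rest is arithmetic of degrees. -/

/-! ### Test functions and integrability. -/

/-- The algebra of functions `ℝ → ℝ` spanned by polynomials and compactly supported smooth
functions. -/
def testAlgebra : Subalgebra ℝ (ℝ → ℝ) where
  carrier := {u | ∃ (q : ℝ[X]) (g : ℝ → ℝ), ContDiff ℝ ∞ g ∧ HasCompactSupport g ∧
    u = (fun x => q.eval x) + g}
  mul_mem' := by
    rintro _ _ ⟨q, g, hg, hgc, rfl⟩ ⟨q', g', hg', hgc', rfl⟩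
    have hq : ContDiff ℝ ∞ (fun x => q.eval x) := by simpa using q.contDiff_aeval (𝕜 := ℝ) ∞
    have hq' : ContDiff ℝ ∞ (fun x => q'.eval x) := by simpa using q'.contDiff_aeval (𝕜 := ℝ) ∞
    refine ⟨q * q', (fun x => q.eval x) * g' + g * ((fun x => q'.eval x) + g'),
      (hq.mul hg').add (hg.mul (hq'.add hg')), hgc'.mul_left.add hgc.mul_right, ?_⟩
    ext x
    simp only [Pi.mul_apply, Pi.add_apply, eval_mul]
    ring
  add_mem' := by
    rintro _ _ ⟨q, g, hg, hgc, rfl⟩ ⟨q', g', hg', hgc', rfl⟩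
    refine ⟨q + q', g + g', hg.add hg', hgc.add hgc', ?_⟩
    ext x
    simp only [Pi.add_apply, eval_add]
    ring
  algebraMap_mem' r := by
    refine ⟨C r, 0, contDiff_const, HasCompactSupport.zero, ?_⟩
    ext x
    simp

theorem eval_mem_testAlgebra (q : ℝ[X]) : (fun x => q.eval x) ∈ testAlgebra :=
  ⟨q, 0, contDiff_const, HasCompactSupport.zero, by simp⟩

theorem bump_mem_testAlgebra {g : ℝ → ℝ} (hg : ContDiff ℝ ∞ g) (hgc : HasCompactSupport g) :
    g ∈ testAlgebra :=
  ⟨0, g, hg, hgc, by ext x; simp⟩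

theorem contDiff_of_mem_testAlgebra {u : ℝ → ℝ} (hu : u ∈ testAlgebra) : ContDiff ℝ ∞ u := by
  obtain ⟨q, g, hg, -, rfl⟩ := hu
  exact ContDiff.add (by simpa using q.contDiff_aeval (𝕜 := ℝ) ∞) hg

theorem differentiable_of_mem_testAlgebra {u : ℝ → ℝ} (hu : u ∈ testAlgebra) :
    Differentiable ℝ u :=
  (contDiff_of_mem_testAlgebra hu).differentiable (by simp)

theorem deriv_mem_testAlgebra {u : ℝ → ℝ} (hu : u ∈ testAlgebra) : deriv u ∈ testAlgebra := by
  obtain ⟨q, g, hg, hgc, rfl⟩ := hu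
  refine ⟨derivative q, deriv g, ?_, hgc.deriv, ?_⟩
  · exact (contDiff_infty_iff_deriv.1 hg).2
  · ext x
    rw [deriv_add q.differentiable.differentiableAt (hg.differentiable (by simp) x)]
    simp

theorem iteratedDeriv_mem_testAlgebra {u : ℝ → ℝ} (hu : u ∈ testAlgebra) (k : ℕ) :
    iteratedDeriv k u ∈ testAlgebra := by
  induction k with
  | zero => simpa using hu
  | succ k ih => rw [iteratedDeriv_succ]; exact deriv_mem_testAlgebra ih

theorem integrableOn_weight_mul {I : Set ℝ} {p : ℝ → ℝ}
    (hp : ∀ q : ℝ[X], IntegrableOn (fun x => p x * q.eval x) I) {u : ℝ → ℝ}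
    (hu : u ∈ testAlgebra) : IntegrableOn (fun x => p x * u x) I := by
  obtain ⟨q, g, hg, hgc, rfl⟩ := hu
  have h1 : IntegrableOn p I := by simpa using hp 1
  obtain ⟨K, hK⟩ := hgc.exists_bound_of_continuous hg.continuous
  have h2 : IntegrableOn (fun x => p x * g x) I := by
    refine (Integrable.bdd_mul (f := g) (g := p) h1 hg.continuous.aestronglyMeasurable
      (c := K) (Filter.Eventually.of_forall hK)).congr ?_
    exact Filter.Eventually.of_forall fun x => mul_comm _ _
  refine ((hp q).add h2).congr (Filter.Eventually.of_forall fun x => ?_)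
  simp only [Pi.add_apply]
  ring

/-! ### Symmetric operators and commutators with x. -/

/-- The operator `∑_{k<N} c_k D^k`. -/
noncomputable def polyDiffOp (c : ℕ → ℝ[X]) (N : ℕ) (u : ℝ → ℝ) (x : ℝ) : ℝ :=
  ∑ k ∈ Finset.range N, (c k).eval x * iteratedDeriv k u x

theorem polyDiffOp_mem_testAlgebra (c : ℕ → ℝ[X]) (N : ℕ) {u : ℝ → ℝ} (hu : u ∈ testAlgebra) :
    polyDiffOp c N u ∈ testAlgebra := by
  have : polyDiffOp c N u =
      ∑ k ∈ Finset.range N, (fun x => (c k).eval x) * iteratedDeriv k u := by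
    ext x
    simp [polyDiffOp]
  rw [this]
  exact Subalgebra.sum_mem _ fun k _ =>
    Subalgebra.mul_mem _ (eval_mem_testAlgebra _) (iteratedDeriv_mem_testAlgebra hu k)

/-- For k = 0 the truncated index k - 1 is harmless, since its coefficient is zero. -/
theorem iteratedDeriv_id_mul {u : ℝ → ℝ} (hu : u ∈ testAlgebra) (k : ℕ) (x : ℝ) :
    iteratedDeriv k (fun y => y * u y) x =
      x * iteratedDeriv k u x + k * iteratedDeriv (k - 1) u x := by
  induction k generalizing x with
  | zero => simp
  | succ k ih =>
    have hd : ∀ j y, HasDerivAt (iteratedDeriv j u) (iteratedDeriv (j + 1) u y) y := by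
      intro j y
      rw [iteratedDeriv_succ]
      exact (differentiable_of_mem_testAlgebra (iteratedDeriv_mem_testAlgebra hu j) y).hasDerivAt
    rw [iteratedDeriv_succ, funext ih]
    have h := ((hasDerivAt_id x).mul (hd k x)).add ((hd (k - 1) x).const_mul (k : ℝ))
    refine (h.deriv).trans ?_
    rcases k with _ | k
    · simp; ring
    · simp; ring

/-- `T = ∑_{k<N} c_k D^k` satisfies `⟨T u, v⟩ = ε ⟨u, T v⟩`. -/
def IsSignSymm (I : Set ℝ) (p : ℝ → ℝ) (ε : ℝ) (c : ℕ → ℝ[X]) (N : ℕ) : Prop :=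
  ∀ u ∈ testAlgebra, ∀ v ∈ testAlgebra,
    ∫ x in I, p x * (polyDiffOp c N u x * v x) = ε * ∫ x in I, p x * (u x * polyDiffOp c N v x)

theorem polyDiffOp_commutator (c : ℕ → ℝ[X]) (N : ℕ) {u : ℝ → ℝ} (hu : u ∈ testAlgebra) (x : ℝ) :
    polyDiffOp c (N + 1) (fun y => y * u y) x - x * polyDiffOp c (N + 1) u x =
      polyDiffOp (fun k => C ((k : ℝ) + 1) * c (k + 1)) N u x := by
  simp only [polyDiffOp, iteratedDeriv_id_mul hu]
  rw [Finset.mul_sum, ← Finset.sum_sub_distrib, Finset.sum_range_succ']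
  simp only [Nat.cast_zero, zero_mul, add_zero]
  rw [show ∀ s t : ℝ, t = 0 → s + t = s by intro s t h; simp [h]]
  · refine Finset.sum_congr rfl fun k _ => ?_
    simp
    ring
  · ring

/-- Moving x across the pairing exchanges the two terms of T x - x T, which flips the sign. -/
theorem IsSignSymm.commutator {I : Set ℝ} {p : ℝ → ℝ}
    (hp : ∀ q : ℝ[X], IntegrableOn (fun x => p x * q.eval x) I) {ε : ℝ} {c : ℕ → ℝ[X]} {N : ℕ}
    (h : IsSignSymm I p ε c (N + 1)) :
    IsSignSymm I p (-ε) (fun k => C ((k : ℝ) + 1) * c (k + 1)) N := by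
  intro u hu v hv
  have hX : (fun x : ℝ => x) ∈ testAlgebra := by simpa using eval_mem_testAlgebra X
  have hXu : (fun x => x * u x) ∈ testAlgebra := Subalgebra.mul_mem _ hX hu
  have hXv : (fun x => x * v x) ∈ testAlgebra := Subalgebra.mul_mem _ hX hv
  have hT : ∀ {w}, w ∈ testAlgebra → polyDiffOp c (N + 1) w ∈ testAlgebra := fun hw =>
    polyDiffOp_mem_testAlgebra c _ hw
  have e1 := h _ hXu v hv
  have e2 := h u hu _ hXv
  have i : ∀ {f g : ℝ → ℝ}, f ∈ testAlgebra → g ∈ testAlgebra →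
      IntegrableOn (fun x => p x * (f x * g x)) I := fun hf hg =>
    integrableOn_weight_mul hp (Subalgebra.mul_mem _ hf hg)
  simp only [← polyDiffOp_commutator c N hu, ← polyDiffOp_commutator c N hv]
  have l : ∫ x in I, p x * ((polyDiffOp c (N + 1) (fun y => y * u y) x -
        x * polyDiffOp c (N + 1) u x) * v x) =
      (∫ x in I, p x * (polyDiffOp c (N + 1) (fun y => y * u y) x * v x)) -
        ∫ x in I, p x * (polyDiffOp c (N + 1) u x * (x * v x)) := by
    rw [← integral_sub (i (hT hXu) hv) (i (hT hu) hXv)]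
    congr 1; ext x; ring
  have r : ∫ x in I, p x * (u x * (polyDiffOp c (N + 1) (fun y => y * v y) x -
        x * polyDiffOp c (N + 1) v x)) =
      (∫ x in I, p x * (u x * polyDiffOp c (N + 1) (fun y => y * v y) x)) -
        ∫ x in I, p x * (x * u x * polyDiffOp c (N + 1) v x) := by
    rw [← integral_sub (i hu (hT hXv)) (i hXu (hT hv))]
    congr 1; ext x; ring
  rw [l, r, e1, e2]
  ring

theorem IsSignSymm.smul {I : Set ℝ} {p : ℝ → ℝ} {ε : ℝ} {c : ℕ → ℝ[X]} {N : ℕ}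
    (h : IsSignSymm I p ε c N) (t : ℝ) : IsSignSymm I p ε (fun k => C t * c k) N := by
  have e : ∀ w x, polyDiffOp (fun k => C t * c k) N w x = t * polyDiffOp c N w x := by
    intro w x
    simp only [polyDiffOp, Finset.mul_sum, eval_mul, eval_C, mul_assoc]
  intro u hu v hv
  have := h u hu v hv
  have l : ∀ w z : ℝ → ℝ, ∀ x, p x * (t * w x * z x) = t * (p x * (w x * z x)) := by
    intros; ring
  have l' : ∀ w z : ℝ → ℝ, ∀ x, p x * (w x * (t * z x)) = t * (p x * (w x * z x)) := by
    intros; ring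
  simp only [e, l, l', integral_const_mul, this]
  ring

/-- Repeated commutators produce the factors (k+m)!/k!; dividing by m + 1 at each stage keeps them
binomial. -/
theorem IsSignSymm.iterate {I : Set ℝ} {p : ℝ → ℝ}
    (hp : ∀ q : ℝ[X], IntegrableOn (fun x => p x * q.eval x) I) {c : ℕ → ℝ[X]} (m N : ℕ)
    (h : IsSignSymm I p 1 c (N + m)) :
    IsSignSymm I p ((-1) ^ m) (fun k => C ((k + m).choose m : ℝ) * c (k + m)) N := by
  induction m generalizing N with
  | zero => simpa using h
  | succ m ih =>
    have h1 := ((ih (N + 1) (by rwa [add_assoc, add_comm 1 m])).commutator hp).smul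
      (((m : ℝ) + 1)⁻¹)
    have e : (fun k : ℕ => C (((m : ℝ) + 1)⁻¹) * (C ((k : ℝ) + 1) *
          (C ((k + 1 + m).choose m : ℝ) * c (k + 1 + m)))) =
        fun k => C ((k + (m + 1)).choose (m + 1) : ℝ) * c (k + (m + 1)) := by
      funext k
      have h2 := Nat.choose_succ_right_eq (k + 1 + m) m
      have h3 : ((k + 1 + m).choose (m + 1) : ℝ) * (m + 1) =
          (k + 1 + m).choose m * (k + 1) := by
        rw [show k + 1 + m - m = k + 1 by omega] at h2
        exact_mod_cast h2
      rw [show k + (m + 1) = k + 1 + m by ring, ← mul_assoc, ← mul_assoc, ← C_mul, ← C_mul]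
      congr 2
      have : (m : ℝ) + 1 ≠ 0 := by positivity
      field_simp
      linarith
    rw [e] at h1
    rwa [pow_succ, mul_neg_one]

theorem polyDiffOp_add (c : ℕ → ℝ[X]) (N : ℕ) {u v : ℝ → ℝ} (hu : u ∈ testAlgebra)
    (hv : v ∈ testAlgebra) : polyDiffOp c N (u + v) = polyDiffOp c N u + polyDiffOp c N v := by
  ext x
  simp only [polyDiffOp, Pi.add_apply, ← Finset.sum_add_distrib]
  refine Finset.sum_congr rfl fun k _ => ?_
  rw [iteratedDeriv_add, mul_add]
  · exact ((contDiff_of_mem_testAlgebra hu).of_le (by exact_mod_cast le_top)).contDiffAt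
  · exact ((contDiff_of_mem_testAlgebra hv).of_le (by exact_mod_cast le_top)).contDiffAt

/-- The entry `a 0` is arbitrary and plays no part in L, so it is replaced by zero. -/
theorem diffOp_eq_polyDiffOp (n : ℕ) (a : ℕ → ℝ[X]) :
    diffOp n a = polyDiffOp (fun k => if k = 0 then 0 else a k) (n + 1) := by
  funext u x
  simp only [diffOp, polyDiffOp]
  rw [← Finset.sum_subset (s₁ := Finset.Icc 1 n) (s₂ := Finset.range (n + 1))]
  · refine Finset.sum_congr rfl fun k hk => ?_
    rw [if_neg (by have := Finset.mem_Icc.1 hk; omega)]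
  · intro k hk
    have := Finset.mem_Icc.1 hk
    exact Finset.mem_range.2 (by omega)
  · intro k hk hk'
    have h0 : k = 0 := by
      have := Finset.mem_range.1 hk
      by_contra h
      exact hk' (Finset.mem_Icc.2 ⟨by omega, by omega⟩)
    simp [h0]

/-- Both pairings are bilinear, and every member of the algebra is a polynomial plus a bump. -/
theorem isSignSymm_of_isTestFunction {I : Set ℝ} {p : ℝ → ℝ}
    (hp : ∀ q : ℝ[X], IntegrableOn (fun x => p x * q.eval x) I) {n : ℕ} {a : ℕ → ℝ[X]}
    (h : ∀ u v : ℝ → ℝ, IsTestFunction u → IsTestFunction v →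
      ∫ x in I, p x * diffOp n a u x * v x = ∫ x in I, p x * u x * diffOp n a v x) :
    IsSignSymm I p 1 (fun k => if k = 0 then 0 else a k) (n + 1) := by
  rw [diffOp_eq_polyDiffOp] at h
  set T := polyDiffOp (fun k => if k = 0 then 0 else a k) (n + 1) with hT
  have hTm : ∀ {w}, w ∈ testAlgebra → T w ∈ testAlgebra := fun hw =>
    polyDiffOp_mem_testAlgebra _ _ hw
  have i : ∀ {f g : ℝ → ℝ}, f ∈ testAlgebra → g ∈ testAlgebra →
      IntegrableOn (fun x => p x * (f x * g x)) I := fun hf hg =>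
    integrableOn_weight_mul hp (Subalgebra.mul_mem _ hf hg)
  have hadd : ∀ {u v}, u ∈ testAlgebra → v ∈ testAlgebra → T (u + v) = T u + T v :=
    fun hu hv => polyDiffOp_add _ _ hu hv
  have ht : ∀ {u}, IsTestFunction u → u ∈ testAlgebra := by
    rintro u (⟨q, rfl⟩ | ⟨h1, h2⟩)
    · exact eval_mem_testAlgebra q
    · exact bump_mem_testAlgebra h1 h2
  have hdec : ∀ u ∈ testAlgebra, ∃ u₁ u₂, IsTestFunction u₁ ∧ IsTestFunction u₂ ∧ u = u₁ + u₂ := by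
    rintro u ⟨q, g, hg, hgc, rfl⟩
    exact ⟨_, _, Or.inl ⟨q, rfl⟩, Or.inr ⟨hg, hgc⟩, rfl⟩
  have key : ∀ u v, IsTestFunction u → IsTestFunction v →
      ∫ x in I, p x * (T u x * v x) = ∫ x in I, p x * (u x * T v x) := by
    intro u v hu hv
    simpa only [mul_assoc] using h u v hu hv
  have addl : ∀ {f f' g : ℝ → ℝ}, f ∈ testAlgebra → f' ∈ testAlgebra → g ∈ testAlgebra →
      ∫ x in I, p x * ((f + f') x * g x) =
        (∫ x in I, p x * (f x * g x)) + ∫ x in I, p x * (f' x * g x) := by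
    intro f f' g hf hf' hg
    rw [← integral_add (i hf hg) (i hf' hg)]
    congr 1; ext x; simp only [Pi.add_apply]; ring
  have addr : ∀ {f g g' : ℝ → ℝ}, f ∈ testAlgebra → g ∈ testAlgebra → g' ∈ testAlgebra →
      ∫ x in I, p x * (f x * (g + g') x) =
        (∫ x in I, p x * (f x * g x)) + ∫ x in I, p x * (f x * g' x) := by
    intro f g g' hf hg hg'
    rw [← integral_add (i hf hg) (i hf hg')]
    congr 1; ext x; simp only [Pi.add_apply]; ring
  intro u hu v hv
  obtain ⟨u₁, u₂, hu₁, hu₂, rfl⟩ := hdec u hu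
  obtain ⟨v₁, v₂, hv₁, hv₂, rfl⟩ := hdec v hv
  have mu₁ := ht hu₁
  have mu₂ := ht hu₂
  have mv₁ := ht hv₁
  have mv₂ := ht hv₂
  rw [← hT, hadd mu₁ mu₂, hadd mv₁ mv₂, addl (hTm mu₁) (hTm mu₂) hv, addr (hTm mu₁) mv₁ mv₂,
    addr (hTm mu₂) mv₁ mv₂, addl mu₁ mu₂ (Subalgebra.add_mem _ (hTm mv₁) (hTm mv₂)),
    addr mu₁ (hTm mv₁) (hTm mv₂), addr mu₂ (hTm mv₁) (hTm mv₂),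
    key _ _ hu₁ hv₁, key _ _ hu₁ hv₂, key _ _ hu₂ hv₁, key _ _ hu₂ hv₂, one_mul]

/-! ### The first and third order equations in weak form. -/

/-- Pairing the commutator identity with the constant function `1`. -/
theorem IsSignSymm.integral_eq {I : Set ℝ} {p : ℝ → ℝ}
    (hp : ∀ q : ℝ[X], IntegrableOn (fun x => p x * q.eval x) I) {ε : ℝ} {c : ℕ → ℝ[X]} {N : ℕ}
    (h : IsSignSymm I p ε c (N + 1)) {u : ℝ → ℝ} (hu : u ∈ testAlgebra) :
    ∫ x in I, p x * (polyDiffOp c (N + 1) u x - ε * ((c 0).eval x * u x)) = 0 := by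
  have h1 : (fun _ : ℝ => (1 : ℝ)) ∈ testAlgebra := by simpa using eval_mem_testAlgebra 1
  have e : ∀ x, polyDiffOp c (N + 1) (fun _ : ℝ => (1 : ℝ)) x = (c 0).eval x := by
    intro x
    rw [polyDiffOp, Finset.sum_range_succ']
    simp [iteratedDeriv_const]
  have := h u hu _ h1
  simp only [e, mul_one] at this
  have i1 := integrableOn_weight_mul hp (polyDiffOp_mem_testAlgebra c (N + 1) hu)
  have i2 := integrableOn_weight_mul hp (Subalgebra.mul_mem _ hu (eval_mem_testAlgebra (c 0)))
  simp only [Pi.mul_apply] at i2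
  have : ∫ x in I, (p x * polyDiffOp c (N + 1) u x - ε * (p x * (u x * (c 0).eval x))) = 0 := by
    rw [integral_sub i1 (i2.const_mul ε), integral_const_mul, this, sub_self]
  rw [← this]
  congr 1; ext x; ring

theorem integral_weight_mul_eq_zero_of_eq {I : Set ℝ} {p f g : ℝ → ℝ}
    (h : ∫ x in I, p x * f x = 0) (t : ℝ) (hfg : ∀ x, g x = t * f x) :
    ∫ x in I, p x * g x = 0 := by
  have : ∀ x, p x * g x = t * (p x * f x) := fun x => by rw [hfg]; ring
  simp only [this, integral_const_mul, h, mul_zero]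

/-- The first and third order symmetry equations of a self-adjoint operator, in weak form. -/
structure IsWeakSolution (I : Set ℝ) (p : ℝ → ℝ) (n : ℕ) (a b c d : ℝ[X]) : Prop where
  integrable : ∀ q : ℝ[X], IntegrableOn (fun x => p x * q.eval x) I
  first : ∀ u ∈ testAlgebra,
    ∫ x in I, p x * (n * a.eval x * deriv u x + 2 * b.eval x * u x) = 0
  third : ∀ u ∈ testAlgebra,
    ∫ x in I, p x * (((n : ℝ) - 1) / 6 * b.eval x * deriv (deriv u) x + c.eval x * deriv u x +
      2 / ((n : ℝ) - 2) * d.eval x * u x) = 0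

theorem isWeakSolution_of_isSignSymm {I : Set ℝ} {p : ℝ → ℝ}
    (hp : ∀ q : ℝ[X], IntegrableOn (fun x => p x * q.eval x) I) {n : ℕ} (hn : 4 ≤ n)
    (hev : Even n) {c : ℕ → ℝ[X]} (h : IsSignSymm I p 1 c (n + 1)) :
    IsWeakSolution I p n (c n) (c (n - 1)) (c (n - 2)) (c (n - 3)) := by
  obtain ⟨m, rfl⟩ : ∃ m, n = m + 3 := ⟨n - 3, by omega⟩
  -- Both m and m + 2 commutators are taken below; oddness makes both results antisymmetric, so the
  -- zeroth order terms double.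
  have hm : Odd m := by
    rcases Nat.even_or_odd m with h' | h'
    · exact absurd hev (by rw [Nat.not_even_iff_odd]; exact h'.add_odd (by decide))
    · exact h'
  have first : ∀ u ∈ testAlgebra,
      ∫ x in I, p x * (((m + 3 : ℕ) : ℝ) * (c (m + 3)).eval x * deriv u x +
        2 * (c (m + 2)).eval x * u x) = 0 := by
    intro u hu
    have h2 := (IsSignSymm.iterate hp (m + 2) 2 (by convert h using 1; omega)).integral_eq hp hu
    refine integral_weight_mul_eq_zero_of_eq h2 1 fun x => ?_
    have e : ((-1 : ℝ)) ^ (m + 2) = -1 := Odd.neg_one_pow (hm.add_even (by decide))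
    have c1 : (1 + (m + 2)).choose (m + 2) = m + 3 := by
      rw [show 1 + (m + 2) = (m + 2) + 1 by ring, Nat.choose_succ_self_right]
    rw [e, polyDiffOp]
    simp only [Finset.sum_range_succ, Finset.sum_range_zero, c1, iteratedDeriv_zero,
      iteratedDeriv_one, eval_mul, eval_C, zero_add, Nat.choose_self]
    rw [show 1 + (m + 2) = m + 3 by ring]
    push_cast
    ring
  refine ⟨hp, first, fun u hu => ?_⟩
  have h2 := (IsSignSymm.iterate hp m 4 (by convert h using 1; omega)).integral_eq hp hu
  have hu2 := deriv_mem_testAlgebra (deriv_mem_testAlgebra hu)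
  have h1 := first _ hu2
  rw [Odd.neg_one_pow hm] at h2
  have c1 : (1 + m).choose m = m + 1 := by
    rw [show 1 + m = m + 1 by ring, Nat.choose_succ_self_right]
  have c2 : (((2 + m).choose m : ℕ) : ℝ) = (m + 2) * (m + 1) / 2 := by
    rw [show (2 + m).choose m = (2 + m).choose 2 from Nat.choose_symm_of_eq_add (by ring),
      Nat.cast_choose_two]
    push_cast; ring
  have c3 : (((3 + m).choose m : ℕ) : ℝ) = (m + 3) * (m + 2) * (m + 1) / 6 := by
    have h3 := Nat.choose_succ_right_eq (3 + m) 2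
    have h4 : (((3 + m).choose 3 : ℕ) : ℝ) * 3 = (3 + m).choose 2 * (m + 1) := by
      rw [show 3 + m - 2 = m + 1 by omega] at h3
      exact_mod_cast h3
    rw [Nat.cast_choose_two] at h4
    rw [show (3 + m).choose m = (3 + m).choose 3 from Nat.choose_symm_of_eq_add (by ring)]
    push_cast at h4
    linarith
  simp only [polyDiffOp, Finset.sum_range_succ, Finset.sum_range_zero, iteratedDeriv_zero,
    iteratedDeriv_one, eval_mul, eval_C, zero_add, Nat.choose_self, c1, c2, c3] at h2
  have d2 : iteratedDeriv 2 u = deriv (deriv u) := by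
    rw [iteratedDeriv_succ, iteratedDeriv_one]
  have d3 : iteratedDeriv 3 u = deriv (deriv (deriv u)) := by
    rw [iteratedDeriv_succ, d2]
  simp only [d2, d3] at h2
  have hX : ∀ (q : ℝ[X]) {w}, w ∈ testAlgebra → (fun x => q.eval x * w x) ∈ testAlgebra :=
    fun q w hw => Subalgebra.mul_mem _ (eval_mem_testAlgebra q) hw
  have i1 : IntegrableOn (fun x => p x * (((m + 3 : ℕ) : ℝ) * (c (m + 3)).eval x *
      deriv (deriv (deriv u)) x + 2 * (c (m + 2)).eval x * deriv (deriv u) x)) I := by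
    refine integrableOn_weight_mul hp (u := fun x => ((m + 3 : ℕ) : ℝ) * (c (m + 3)).eval x *
      deriv (deriv (deriv u)) x + 2 * (c (m + 2)).eval x * deriv (deriv u) x) ?_
    have := Subalgebra.add_mem _ (hX (C ((m + 3 : ℕ) : ℝ) * c (m + 3)) (deriv_mem_testAlgebra hu2))
      (hX (C 2 * c (m + 2)) hu2)
    convert this using 1
    ext x
    simp
  have i2 : IntegrableOn (fun x => p x * (((m : ℝ) + 2) * (m + 1) / 6 * (c (m + 2)).eval x *
      deriv (deriv u) x +
        ((m : ℝ) + 1) * (c (m + 1)).eval x * deriv u x + 2 * (c m).eval x * u x)) I := by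
    refine integrableOn_weight_mul hp (u := fun x => ((m : ℝ) + 2) * (m + 1) / 6 * (c (m + 2)).eval x *
      deriv (deriv u) x +
        ((m : ℝ) + 1) * (c (m + 1)).eval x * deriv u x + 2 * (c m).eval x * u x) ?_
    have := Subalgebra.add_mem _ (Subalgebra.add_mem _
      (hX (C (((m : ℝ) + 2) * (m + 1) / 6) * c (m + 2)) hu2)
      (hX (C ((m : ℝ) + 1) * c (m + 1)) (deriv_mem_testAlgebra hu))) (hX (C 2 * c m) hu)
    convert this using 1
    ext x
    simp
  have h3 : ∫ x in I, p x * (((m : ℝ) + 2) * (m + 1) / 6 * (c (m + 2)).eval x *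
      deriv (deriv u) x +
        ((m : ℝ) + 1) * (c (m + 1)).eval x * deriv u x + 2 * (c m).eval x * u x) = 0 := by
    -- C(n,3) = n (n-1)(n-2)/6, so removing (n-1)(n-2)/6 times the first equation for u'' cancels
    -- u'''. The factor m + 1 = n - 2 is divided out afterwards.
    have e := integral_add (i1.const_mul ((m + 2) * (m + 1) / 6)) i2
    rw [integral_const_mul, h1, mul_zero, zero_add] at e
    rw [← e, ← h2]
    congr 1; ext x
    rw [show 1 + m = m + 1 by ring, show 2 + m = m + 2 by ring, show 3 + m = m + 3 by ring]
    push_cast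
    ring
  refine integral_weight_mul_eq_zero_of_eq h3 (((m : ℝ) + 1)⁻¹) fun x => ?_
  have hm0 : (m : ℝ) + 1 ≠ 0 := by positivity
  have hm1 : ((m + 3 : ℕ) : ℝ) - 2 = m + 1 := by push_cast; ring
  rw [hm1, show m + 3 - 1 = m + 2 by omega, show m + 3 - 2 = m + 1 by omega,
    show m + 3 - 3 = m by omega]
  push_cast
  field_simp
  ring

/-! ### Elimination of the weight. -/

theorem ae_eval_ne_zero {q : ℝ[X]} (hq : q ≠ 0) : ∀ᵐ x : ℝ, q.eval x ≠ 0 := by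
  have : {x | q.eval x = 0}.Finite := (q.rootSet_finite ℝ).subset fun x hx => by
    rw [mem_rootSet]
    exact ⟨hq, by simpa using hx⟩
  exact measure_eq_zero_iff_ae_notMem.1 (this.measure_zero volume)

theorem eq_zero_of_integral_weight_mul_sq {I : Set ℝ} (hI : MeasurableSet I) {p : ℝ → ℝ}
    (hp : ∀ q : ℝ[X], IntegrableOn (fun x => p x * q.eval x) I) (hnonneg : ∀ x ∈ I, 0 ≤ p x)
    (hnz : ¬ ∀ᵐ x, x ∈ I → p x = 0) {q : ℝ[X]} (h : ∫ x in I, p x * (q * q).eval x = 0) :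
    q = 0 := by
  by_contra hq
  apply hnz
  have h0 : 0 ≤ᵐ[volume.restrict I] fun x => p x * (q * q).eval x :=
    (ae_restrict_iff' hI).2 (Filter.Eventually.of_forall fun x hx => by
      have := hnonneg x hx
      simp only [eval_mul, Pi.zero_apply]
      exact mul_nonneg this (mul_self_nonneg _))
  have h1 := (integral_eq_zero_iff_of_nonneg_ae h0 (hp (q * q))).1 h
  filter_upwards [(ae_restrict_iff' hI).1 h1, ae_eval_ne_zero hq] with x hx hqx hxI
  have := hx hxI
  simpa [hqx] using this

/-- The polynomial `a γ`, where `p γ` is the quantity whose derivative is controlled by the third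
order symmetry equation. -/
noncomputable def fluxPoly (n : ℕ) (a b c : ℝ[X]) : ℝ[X] :=
  a * c - C (((n : ℝ) - 1) / 6) *
    (a * derivative b + (C (2 / (n : ℝ)) * b - derivative a) * b)

/-- The compatibility relation forced by the first and third order symmetry equations. -/
def IsFluxRelation (n : ℕ) (a b c d : ℝ[X]) : Prop :=
  a * derivative (fluxPoly n a b c) +
    (C (2 / (n : ℝ)) * b - 2 * derivative a) * fluxPoly n a b c =
  C (2 / ((n : ℝ) - 2)) * d * a ^ 2

/-- With R the defect of the relation, (pγ)' - 2dp/(n-2) is formally pR/a². Testing against a²R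
gives ∫ p R² = 0, so R = 0. Only polynomial test functions are used, so p need not be
differentiated. -/
theorem IsWeakSolution.isFluxRelation {I : Set ℝ} (hI : MeasurableSet I) {p : ℝ → ℝ} {n : ℕ}
    (hn : n ≠ 0) {a b c d : ℝ[X]} (h : IsWeakSolution I p n a b c d)
    (hnonneg : ∀ x ∈ I, 0 ≤ p x) (hnz : ¬ ∀ᵐ x, x ∈ I → p x = 0) :
    IsFluxRelation n a b c d := by
  have hn' : (n : ℝ) ≠ 0 := by exact_mod_cast hn
  set Q := fluxPoly n a b c with hQ
  set R := a * derivative Q + (C (2 / (n : ℝ)) * b - 2 * derivative a) * Q -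
    C (2 / ((n : ℝ) - 2)) * d * a ^ 2 with hR
  have hder : ∀ q : ℝ[X], deriv (fun x => q.eval x) = fun x => (derivative q).eval x := by
    intro q; ext x; simp
  -- With κ = (n-1)/6 and f = a²R, this is (κ b f' + γ f)/a, a polynomial. Formally (p a g)' = p (a
  -- g' + (2/n) b g), and subtracting the third order integrand for f leaves p R².
  set g := C (((n : ℝ) - 1) / 6) * b * (2 * derivative a * R + a * derivative R) + Q * R with hg
  have e1 := h.first _ (eval_mem_testAlgebra g)
  have e2 := h.third _ (eval_mem_testAlgebra (a ^ 2 * R))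
  simp only [hder] at e1 e2
  have key : R * R = C (n : ℝ)⁻¹ * (C (n : ℝ) * a * derivative g + 2 * b * g) -
      (C (((n : ℝ) - 1) / 6) * b * derivative (derivative (a ^ 2 * R)) +
        c * derivative (a ^ 2 * R) + C (2 / ((n : ℝ) - 2)) * d * (a ^ 2 * R)) := by
    have t1 : C (n : ℝ)⁻¹ * C (n : ℝ) = (1 : ℝ[X]) := by
      rw [← C_mul, inv_mul_cancel₀ hn', C_1]
    have t2 : (C (2 / (n : ℝ)) : ℝ[X]) = 2 * C (n : ℝ)⁻¹ := by
      rw [div_eq_mul_inv, C_mul]; rfl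
    have t3 : C (n : ℝ)⁻¹ * (C (n : ℝ) * a * derivative g + 2 * b * g) =
        a * derivative g + C (2 / (n : ℝ)) * b * g := by
      rw [t2]; linear_combination a * derivative g * t1
    have t4 : R * R = (a * derivative Q + (C (2 / (n : ℝ)) * b - 2 * derivative a) * Q -
      C (2 / ((n : ℝ) - 2)) * d * a ^ 2) * R := by rw [← hR]
    have t5 : Q = a * c - C (((n : ℝ) - 1) / 6) *
      (a * derivative b + (C (2 / (n : ℝ)) * b - derivative a) * b) := rfl
    rw [t3, t4, hg]
    clear_value R g
    have t6 : a * c = Q + C (((n : ℝ) - 1) / 6) *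
      (a * derivative b + (C (2 / (n : ℝ)) * b - derivative a) * b) := by rw [t5]; ring
    clear_value Q
    simp only [derivative_add, derivative_mul, derivative_pow, derivative_C, derivative_ofNat]
    push_cast
    simp only [C_ofNat, C_1, pow_one]
    linear_combination (2 * derivative a * R + a * derivative R) * t6
  clear_value R g
  generalize a ^ 2 * R = f at e2 key
  have i1 : IntegrableOn (fun x => p x * (n * a.eval x * (derivative g).eval x +
      2 * b.eval x * g.eval x)) I := by
    simpa only [eval_add, eval_mul, eval_C, eval_ofNat] using
      h.integrable (C (n : ℝ) * a * derivative g + 2 * b * g)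
  have i2 : IntegrableOn (fun x => p x * (((n : ℝ) - 1) / 6 * b.eval x *
      (derivative (derivative f)).eval x + c.eval x * (derivative f).eval x +
      2 / ((n : ℝ) - 2) * d.eval x * f.eval x)) I := by
    simpa only [eval_add, eval_mul, eval_C] using
      h.integrable (C (((n : ℝ) - 1) / 6) * b * derivative (derivative f) +
        c * derivative f + C (2 / ((n : ℝ) - 2)) * d * f)
  have e3 : ∫ x in I, p x * (R * R).eval x = 0 := by
    have := integral_sub (i1.const_mul (n : ℝ)⁻¹) i2
    rw [integral_const_mul, e1, e2, mul_zero, sub_zero] at this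
    rw [← this]
    congr 1; ext x
    rw [key]
    simp only [eval_add, eval_mul, eval_C, eval_sub, eval_ofNat]
    ring
  have := eq_zero_of_integral_weight_mul_sq hI h.integrable hnonneg hnz e3
  rw [hR] at this
  exact sub_eq_zero.1 this

/-- Under these degree bounds b² dominates Q. If the conclusion failed, the only term of degree 3
deg b in the relation would be a nonzero multiple of b³. -/
theorem IsFluxRelation.natDegree_le {n : ℕ} (hn : 4 ≤ n) {a b c d : ℝ[X]}
    (h : IsFluxRelation n a b c d) (hc : c.natDegree ≤ n - 2) (hd : d.natDegree ≤ n - 3)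
    (hab : a.natDegree ≤ b.natDegree) (hlt : n - 2 + a.natDegree < 2 * b.natDegree) :
    3 * b.natDegree ≤ n - 3 + 2 * a.natDegree := by
  by_contra! hcon
  set A := a.natDegree with hA
  set B := b.natDegree with hB
  have hB1 : 1 ≤ B := by omega
  have hb : b ≠ 0 := by
    rintro rfl
    simp at hB
    omega
  have hbB : b.coeff B ≠ 0 := by rwa [hB, coeff_natDegree, Ne, leadingCoeff_eq_zero]
  have hda : (derivative a).natDegree ≤ B - 1 := (natDegree_derivative_le a).trans (by omega)
  have hdb : (derivative b).natDegree ≤ B - 1 := (natDegree_derivative_le b).trans (by omega)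
  have hsmall : ∀ {f g : ℝ[X]} {k l m : ℕ}, f.natDegree ≤ k → g.natDegree ≤ l → k + l < m →
      (f * g).coeff m = 0 := fun hf hg hm =>
    coeff_eq_zero_of_natDegree_lt ((natDegree_mul_le_of_le hf hg).trans_lt hm)
  set Q := fluxPoly n a b c with hQ
  have hQe : Q = a * c - C (((n : ℝ) - 1) / 6) * (a * derivative b) -
      C (((n : ℝ) - 1) / 6 * (2 / n)) * (b * b) + C (((n : ℝ) - 1) / 6) * (derivative a * b) := by
    rw [hQ, fluxPoly, C_mul]; ring
  have hQc : Q.coeff (B + B) = -(((n : ℝ) - 1) / 6 * (2 / n)) * (b.coeff B * b.coeff B) := by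
    rw [hQe]
    simp only [coeff_add, coeff_sub, coeff_C_mul]
    rw [hsmall le_rfl hc (by omega), hsmall (le_of_eq hA.symm) hdb (by omega),
      hsmall hda (le_of_eq hB.symm) (by omega),
      coeff_mul_add_eq_of_natDegree_le (le_of_eq hB.symm) (le_of_eq hB.symm)]
    ring
  have hQd : Q.natDegree ≤ B + B := by
    rw [hQe]
    refine natDegree_add_le_of_degree_le ((natDegree_sub_le_of_le
      ((natDegree_sub_le_of_le ?_ ?_).trans_eq (max_self _)) ?_).trans_eq (max_self _)) ?_
    · exact (natDegree_mul_le_of_le le_rfl hc).trans (by omega)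
    · exact (natDegree_C_mul_le _ _).trans ((natDegree_mul_le_of_le le_rfl hdb).trans (by omega))
    · exact (natDegree_C_mul_le _ _).trans (natDegree_mul_le_of_le le_rfl le_rfl)
    · exact (natDegree_C_mul_le _ _).trans ((natDegree_mul_le_of_le hda le_rfl).trans (by omega))
  have hQd' : (derivative Q).natDegree ≤ B + B - 1 := (natDegree_derivative_le Q).trans (by omega)
  have h' : a * derivative Q + C (2 / (n : ℝ)) * (b * Q) - C 2 * (derivative a * Q) =
      C (2 / ((n : ℝ) - 2)) * (d * (a * a)) := by
    have : IsFluxRelation n a b c d := h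
    rw [IsFluxRelation, ← hQ] at this
    rw [show (C 2 : ℝ[X]) = 2 from rfl]
    linear_combination this
  have h3 := congrArg (fun q => coeff q (B + (B + B))) h'
  simp only [coeff_add, coeff_sub, coeff_C_mul] at h3
  rw [hsmall le_rfl hQd' (by omega), hsmall hda hQd (by omega),
    hsmall hd (natDegree_mul_le_of_le le_rfl le_rfl) (by omega),
    coeff_mul_add_eq_of_natDegree_le (le_of_eq hB.symm) hQd, hQc] at h3
  have hn1 : (n : ℝ) - 1 ≠ 0 := by
    have : (4 : ℝ) ≤ n := by exact_mod_cast hn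
    linarith
  have hn0 : (n : ℝ) ≠ 0 := by
    have : (4 : ℝ) ≤ n := by exact_mod_cast hn
    linarith
  simp [hn1, hn0, hbB] at h3

/-- At a multiple root of `a` the relation forces `b` to vanish. -/
theorem IsFluxRelation.eval_eq_zero {n : ℕ} (hn : 4 ≤ n) {a b c d : ℝ[X]}
    (h : IsFluxRelation n a b c d) {r : ℝ} (ha : a.eval r = 0) (ha' : (derivative a).eval r = 0) :
    b.eval r = 0 := by
  have hn' : (4 : ℝ) ≤ n := by exact_mod_cast hn
  have h1 := congrArg (eval r) h
  simp only [fluxPoly, eval_add, eval_mul, eval_sub, eval_C, eval_pow, eval_ofNat, ha, ha'] at h1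
  have hn1 : (n : ℝ) - 1 ≠ 0 := by linarith
  have hn0 : (n : ℝ) ≠ 0 := by linarith
  by_contra hb
  simp [hn1, hn0, hb] at h1

/-- At a simple root of `a` not shared by `b` there are two possible exponents. -/
theorem IsFluxRelation.eval_cases {n : ℕ} (hn : 4 ≤ n) {a b c d : ℝ[X]}
    (h : IsFluxRelation n a b c d) {r : ℝ} (ha : a.eval r = 0) (hb : b.eval r ≠ 0) :
    2 / n * b.eval r - (derivative a).eval r = 0 ∨
      2 / n * b.eval r - 2 * (derivative a).eval r = 0 := by
  have hn' : (4 : ℝ) ≤ n := by exact_mod_cast hn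
  have h1 := congrArg (eval r) h
  simp only [fluxPoly, eval_add, eval_mul, eval_sub, eval_C, eval_pow, eval_ofNat, ha] at h1
  -- Since p'/p = (2b/n - a')/a, the two factors below correspond to p having exponent 0 or 1 at r.
  have hn1 : (n : ℝ) - 1 ≠ 0 := by linarith
  have h2 : (2 / n * b.eval r - (derivative a).eval r) *
      (2 / n * b.eval r - 2 * (derivative a).eval r) = 0 := by
    have : (((n : ℝ) - 1) / 6 * b.eval r) * ((2 / n * b.eval r - (derivative a).eval r) *
      (2 / n * b.eval r - 2 * (derivative a).eval r)) = 0 := by linear_combination -h1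
    rcases mul_eq_zero.1 this with h3 | h3
    · exact absurd h3 (mul_ne_zero (div_ne_zero hn1 (by norm_num)) hb)
    · exact h3
  exact mul_eq_zero.1 h2

/-! ### From weak to classical solutions. -/

theorem contDiff_of_contDiffOn_of_tsupport_subset {J : Set ℝ} (hJ : IsOpen J) {f : ℝ → ℝ}
    (hf : ContDiffOn ℝ ∞ f J) (hs : tsupport f ⊆ J) : ContDiff ℝ ∞ f := by
  refine contDiff_iff_contDiffAt.2 fun x => ?_
  by_cases hx : x ∈ tsupport f
  · exact hf.contDiffAt (hJ.mem_nhds (hs hx))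
  · exact contDiffAt_const.congr_of_eventuallyEq (notMem_tsupport_iff_eventuallyEq.1 hx)

/-- Integrating from a point left of the support gives zero before it, and zero after it because the
total integral vanishes. -/
theorem exists_compactSupport_primitive {J : Set ℝ} (hJ : J.OrdConnected)
    {ψ : ℝ → ℝ} (hψ : ContDiff ℝ ∞ ψ) (hc : HasCompactSupport ψ) (hs : tsupport ψ ⊆ J)
    (h0 : ∫ x, ψ x = 0) :
    ∃ χ : ℝ → ℝ, ContDiff ℝ ∞ χ ∧ HasCompactSupport χ ∧ tsupport χ ⊆ J ∧
      ∀ x, HasDerivAt χ (ψ x) x := by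
  rcases (tsupport ψ).eq_empty_or_nonempty with he | hne
  · have : ψ = 0 := tsupport_eq_empty_iff.1 he
    subst this
    exact ⟨0, contDiff_const, HasCompactSupport.zero, by simp, fun x => hasDerivAt_const x 0⟩
  set l := sInf (tsupport ψ)
  set m := sSup (tsupport ψ)
  have hl : l ∈ tsupport ψ := hc.sInf_mem hne
  have hm : m ∈ tsupport ψ := hc.sSup_mem hne
  have hlm : ∀ x, x ∉ Set.Icc l m → ψ x = 0 := by
    intro x hx
    by_contra h
    have hx' : x ∈ tsupport ψ := subset_tsupport _ h
    exact hx ⟨csInf_le hc.bddBelow hx', le_csSup hc.bddAbove hx'⟩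
  have hder : ∀ x, HasDerivAt (fun x => ∫ t in (l - 1)..x, ψ t) (ψ x) x := fun x =>
    intervalIntegral.integral_hasDerivAt_right (hψ.continuous.intervalIntegrable _ _)
      (hψ.continuous.stronglyMeasurableAtFilter _ _) hψ.continuous.continuousAt
  have hsub : tsupport (fun x => ∫ t in (l - 1)..x, ψ t) ⊆ Set.Icc l m := by
    refine closure_minimal (fun x hx => ?_) isClosed_Icc
    by_contra hxn
    apply hx
    rw [Set.mem_Icc, not_and_or, not_le, not_le] at hxn
    rcases hxn with h | h
    · refine (intervalIntegral.integral_congr (g := fun _ => 0) fun t ht => ?_).trans (by simp)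
      refine hlm t fun ht' => ?_
      rw [Set.uIcc, Set.mem_Icc] at ht
      have : max (l - 1) x < l := max_lt (by linarith) h
      linarith [ht.2, ht'.1]
    · simp only
      rw [intervalIntegral.integral_eq_integral_of_support_subset, h0]
      intro t ht
      have : t ∈ Set.Icc l m := by
        by_contra h'
        exact ht (hlm t h')
      exact ⟨by linarith [this.1], by linarith [this.2]⟩
  refine ⟨fun x => ∫ t in (l - 1)..x, ψ t, ?_, ?_, hsub.trans (hJ.out (hs hl) (hs hm)), hder⟩
  · refine contDiff_infty_iff_deriv.2 ⟨fun x => (hder x).differentiableAt, ?_⟩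
    rwa [show deriv (fun x => ∫ t in (l - 1)..x, ψ t) = ψ from funext fun x => (hder x).deriv]
  · exact isCompact_Icc.of_isClosed_subset (isClosed_tsupport _) hsub

/-- The du Bois-Reymond lemma on an interval. -/
theorem exists_ae_eq_const_of_integral_mul_deriv_eq_zero {J : Set ℝ} (hJo : IsOpen J)
    (hJ : J.OrdConnected) {f : ℝ → ℝ} (hf : LocallyIntegrableOn f J)
    (h : ∀ χ : ℝ → ℝ, ContDiff ℝ ∞ χ → HasCompactSupport χ → tsupport χ ⊆ J →
      ∫ x, f x * deriv χ x = 0) :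
    ∃ K : ℝ, ∀ᵐ x, x ∈ J → f x = K := by
  rcases J.eq_empty_or_nonempty with rfl | ⟨x₀, hx₀⟩
  · exact ⟨0, by simp⟩
  obtain ⟨ε, hε, hball⟩ := Metric.isOpen_iff.1 hJo x₀ hx₀
  let B : ContDiffBump x₀ := ⟨ε / 4, ε / 2, by positivity, by linarith⟩
  set η := B.normed volume with hη
  have hηs : tsupport η ⊆ J := by
    rw [hη, B.tsupport_normed_eq]
    exact (Metric.closedBall_subset_ball (by change ε / 2 < ε; linarith)).trans hball
  have hηc : HasCompactSupport η := B.hasCompactSupport_normed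
  have hηd : ContDiff ℝ ∞ η := B.contDiff_normed
  have hη1 : ∫ x, η x = 1 := B.integral_normed
  have hint : ∀ g : ℝ → ℝ, ContDiff ℝ ∞ g → HasCompactSupport g → tsupport g ⊆ J →
      Integrable (fun x => f x * g x) := by
    intro g hg hgc hgs
    have h1 : IntegrableOn f (tsupport g) := hf.integrableOn_compact_subset hgs hgc
    have h2 : IntegrableOn (fun x => f x * g x) (tsupport g) :=
      h1.mul_continuousOn hg.continuous.continuousOn hgc
    refine (integrableOn_iff_integrable_of_support_subset fun x hx => ?_).1 h2
    exact subset_tsupport _ (right_ne_zero_of_mul hx)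
  refine ⟨∫ x, f x * η x, ?_⟩
  set K := ∫ x, f x * η x with hK
  have key := hJo.ae_eq_zero_of_integral_contDiff_smul_eq_zero (f := fun x => f x - K)
    (μ := volume) (hf.sub ((continuous_const.locallyIntegrable).locallyIntegrableOn J)) ?_
  · filter_upwards [key] with x hx hxJ
    exact sub_eq_zero.1 (hx hxJ)
  intro g hg hgc hgs
  set s := ∫ x, g x with hs
  have hgi : Integrable g := hg.continuous.integrable_of_hasCompactSupport hgc
  have hηi : Integrable η := hηd.continuous.integrable_of_hasCompactSupport hηc
  -- Subtracting s η, where η has integral one, makes g a derivative of an admissible test function.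
  have d1 : ContDiff ℝ ∞ (fun x => g x - s * η x) := hg.sub (contDiff_const.mul hηd)
  have hs1 : tsupport (fun x => g x - s * η x) ⊆ tsupport g ∪ tsupport η := by
    refine closure_minimal (fun x hx => ?_) ((isClosed_tsupport _).union (isClosed_tsupport _))
    by_contra hn
    rw [Set.mem_union, not_or] at hn
    apply hx
    simp [image_eq_zero_of_notMem_tsupport hn.1, image_eq_zero_of_notMem_tsupport hn.2]
  have c1 : HasCompactSupport (fun x => g x - s * η x) :=
    (hgc.isCompact.union hηc.isCompact).of_isClosed_subset (isClosed_tsupport _) hs1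
  have z1 : ∫ x, (g x - s * η x) = 0 := by
    rw [integral_sub hgi (hηi.const_mul s), integral_const_mul, hη1, mul_one, sub_self]
  obtain ⟨χ, hχ, hχc, hχs, hχd⟩ := exists_compactSupport_primitive hJ d1 c1
    (hs1.trans (Set.union_subset hgs hηs)) z1
  have e := h χ hχ hχc hχs
  simp only [fun x => (hχd x).deriv] at e
  have e2 : ∫ x, f x * (g x - s * η x) = (∫ x, f x * g x) - s * K := by
    rw [hK, ← integral_const_mul, ← integral_sub (hint g hg hgc hgs)
      ((hint η hηd hηc hηs).const_mul s)]
    congr 1; ext x; ring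
  rw [e2] at e
  have e3 : ∫ x, g x • (f x - K) = (∫ x, f x * g x) - K * s := by
    rw [hs, ← integral_const_mul, ← integral_sub (hint g hg hgc hgs) (hgi.const_mul K)]
    congr 1; ext x; simp only [smul_eq_mul]; ring
  rw [e3]
  linarith

/-- An integrable function with all moments solving `n (a P)' = 2 b P` weakly on `ℝ` is, on every
interval, a constant multiple of a classical solution. -/
theorem exists_ae_mul_eq_const_mul {P : ℝ → ℝ} {n : ℕ} {a b : ℝ[X]}
    (hP : ∀ q : ℝ[X], Integrable (fun x => P x * q.eval x))
    (h : ∀ u : ℝ → ℝ, ContDiff ℝ ∞ u → HasCompactSupport u →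
      ∫ x, P x * (n * a.eval x * deriv u x + 2 * b.eval x * u x) = 0)
    {J : Set ℝ} (hJo : IsOpen J) (hJ : J.OrdConnected) (hn : n ≠ 0) {M M' : ℝ → ℝ}
    (hM : ContDiffOn ℝ ∞ M J)
    (hM0 : ∀ x ∈ J, M x ≠ 0) (hd : ∀ x ∈ J, HasDerivAt M (M' x) x)
    (heq : ∀ x ∈ J, n * a.eval x * M' x = 2 * b.eval x * M x) :
    ∃ K : ℝ, ∀ᵐ x, x ∈ J → P x * a.eval x = K * M x := by
  have hloc : LocallyIntegrableOn (fun x => (M x)⁻¹ * (P x * a.eval x)) J :=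
    ((hP a).locallyIntegrable.locallyIntegrableOn J).continuousOn_mul
      (hM.continuousOn.inv₀ hM0) hJo.isLocallyClosed
  obtain ⟨K, hK⟩ := exists_ae_eq_const_of_integral_mul_deriv_eq_zero hJo hJ hloc (by
    intro χ hχ hχc hχs
    have hts : tsupport (fun x => χ x * (M x)⁻¹) ⊆ tsupport χ := tsupport_mul_subset_left
    have hu : ContDiff ℝ ∞ (fun x => χ x * (M x)⁻¹) :=
      contDiff_of_contDiffOn_of_tsupport_subset hJo (hχ.contDiffOn.mul (hM.inv hM0))
        (hts.trans hχs)
    have hn' : (n : ℝ) ≠ 0 := by exact_mod_cast hn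
    have e := h _ hu hχc.mul_right
    -- Testing with χ/M cancels the zeroth order term, because M solves the same equation; only
    -- (Pa/M) χ' survives.
    have e' : ∀ x, P x * (n * a.eval x * deriv (fun x => χ x * (M x)⁻¹) x +
        2 * b.eval x * (χ x * (M x)⁻¹)) = n * ((M x)⁻¹ * (P x * a.eval x) * deriv χ x) := by
      intro x
      by_cases hx : x ∈ J
      · have h1 := ((hχ.differentiable (by simp) x).hasDerivAt.mul
          ((hd x hx).inv (hM0 x hx))).deriv
        have h2 : deriv (fun x => χ x * (M x)⁻¹) x =
            deriv χ x * (M x)⁻¹ + χ x * (-M' x / M x ^ 2) := h1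
        rw [h2]
        have := heq x hx
        have hm := hM0 x hx
        field_simp
        linear_combination (-χ x * P x) * this
      · have hx' : x ∉ tsupport χ := fun h' => hx (hχs h')
        have hx'' : x ∉ tsupport (fun x => χ x * (M x)⁻¹) := fun h' => hx' (hts h')
        have z1 : deriv χ x = 0 := by
          by_contra h'
          exact hx' (support_deriv_subset h')
        have z2 : deriv (fun x => χ x * (M x)⁻¹) x = 0 := by
          by_contra h'
          exact hx'' (support_deriv_subset h')
        rw [z1, z2, image_eq_zero_of_notMem_tsupport hx']
        ring
    simp only [e', integral_const_mul] at e
    exact (mul_eq_zero.1 e).resolve_left hn')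
  refine ⟨K, ?_⟩
  filter_upwards [hK] with x hx hxJ
  have := hM0 x hxJ
  rw [← hx hxJ]
  field_simp

theorem exists_pos_solution {J : Set ℝ} (hJo : IsOpen J) (hJ : J.OrdConnected) {h : ℝ → ℝ}
    (hh : ContDiffOn ℝ ∞ h J) :
    ∃ M : ℝ → ℝ, ContDiffOn ℝ ∞ M J ∧ (∀ x, 0 < M x) ∧ ∀ x ∈ J, HasDerivAt M (h x * M x) x := by
  rcases J.eq_empty_or_nonempty with rfl | ⟨x₀, hx₀⟩
  · exact ⟨1, contDiffOn_const, by simp, by simp⟩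
  have hd : ∀ x ∈ J, HasDerivAt (fun x => ∫ t in x₀..x, h t) (h x) x := by
    intro x hx
    refine intervalIntegral.integral_hasDerivAt_right ?_ ?_
      (hh.continuousOn.continuousAt (hJo.mem_nhds hx))
    · exact (hh.continuousOn.mono (hJ.uIcc_subset hx₀ hx)).intervalIntegrable
    · exact hh.continuousOn.stronglyMeasurableAtFilter hJo x hx
  have hs : ContDiffOn ℝ ∞ (fun x => ∫ t in x₀..x, h t) J := by
    refine (contDiffOn_infty_iff_deriv_of_isOpen hJo).2
      ⟨fun x hx => (hd x hx).differentiableAt.differentiableWithinAt, ?_⟩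
    exact hh.congr fun x hx => (hd x hx).deriv
  refine ⟨fun x => Real.exp (∫ t in x₀..x, h t), hs.exp, fun x => Real.exp_pos _, fun x hx => ?_⟩
  rw [mul_comm]
  exact (hd x hx).exp

/-! ### Moments and behaviour at infinity. -/

/-- The derivative of M x^k is M x^(k-1) (x h + k), so M x^k is eventually nondecreasing and
positive. -/
theorem not_integrableOn_mul_pow_of_logDeriv_ge {M h : ℝ → ℝ} {Y : ℝ}
    (hpos : ∀ x ∈ Set.Ioi Y, 0 < M x)
    (hd : ∀ x ∈ Set.Ioi Y, HasDerivAt M (h x * M x) x) (k : ℕ)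
    (hev : ∀ᶠ x in Filter.atTop, 0 ≤ x * h x + k) :
    ¬ IntegrableOn (fun x => M x * x ^ k) (Set.Ioi Y) := by
  intro hint
  obtain ⟨Z₀, hZ₀⟩ := Filter.eventually_atTop.1 hev
  set Z := max Z₀ (max (Y + 1) 1)
  have hZ1 : Z₀ ≤ Z := le_max_left _ _
  have hZ2 : Y + 1 ≤ Z := (le_max_left _ _).trans (le_max_right _ _)
  have hZ3 : 1 ≤ Z := (le_max_right _ _).trans (le_max_right _ _)
  have hder : ∀ x, Z ≤ x → HasDerivAt (fun x => M x * x ^ k)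
      (M x * x ^ k * (x * h x + k) / x) x := by
    intro x hx
    have hx0 : x ≠ 0 := by linarith
    refine ((hd x (by simp only [Set.mem_Ioi]; linarith)).fun_mul
      (hasDerivAt_pow k x)).congr_deriv ?_
    rcases k with _ | k
    · simp; field_simp
    · rw [Nat.add_sub_cancel]
      field_simp
      push_cast
      ring
  have hMpos : ∀ x, Z ≤ x → 0 < M x := fun x hx => hpos x (by simp only [Set.mem_Ioi]; linarith)
  have hmono : MonotoneOn (fun x => M x * x ^ k) (Set.Ici Z) := by
    refine monotoneOn_of_deriv_nonneg (convex_Ici Z)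
      (fun x hx => (hder x hx).continuousAt.continuousWithinAt) ?_ ?_
    · intro x hx
      rw [interior_Ici] at hx
      exact (hder x hx.le).differentiableAt.differentiableWithinAt
    · intro x hx
      rw [interior_Ici] at hx
      have hx' : Z ≤ x := hx.le
      rw [(hder x hx').deriv]
      have := hMpos x hx'
      have hx0 : 0 < x := by linarith
      have := hZ₀ x (by linarith)
      positivity
  have hG : 0 < M Z * Z ^ k := mul_pos (hMpos Z le_rfl) (by positivity)
  have hconst : IntegrableOn (fun _ : ℝ => M Z * Z ^ k) (Set.Ioi Z) := by
    refine Integrable.mono (hint.mono_set (Set.Ioi_subset_Ioi (by linarith)))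
      aestronglyMeasurable_const ((ae_restrict_iff' measurableSet_Ioi).2
        (Filter.Eventually.of_forall fun x hx => ?_))
    have h1 := hmono (Set.mem_Ici.2 le_rfl) (Set.mem_Ici.2 (le_of_lt hx)) (le_of_lt hx)
    simp only [Real.norm_eq_abs]
    rw [abs_of_pos hG]
    exact h1.trans (le_abs_self _)
  rw [integrableOn_const_iff] at hconst
  rcases hconst with h | h
  · exact hG.ne' (enorm_eq_zero.1 h)
  · simp at h

/-- If deg b < deg a then x b/a stays bounded, and a large k makes M x^k nondecreasing. If the
degrees agree and the leading ratio is positive, M itself eventually increases. -/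
theorem degree_le_of_moments_atTop {M : ℝ → ℝ} {Y s : ℝ} (hs : 0 < s) {a b : ℝ[X]}
    (hpos : ∀ x ∈ Set.Ioi Y, 0 < M x)
    (hd : ∀ x ∈ Set.Ioi Y, HasDerivAt M (s * (b.eval x / a.eval x) * M x) x)
    (hint : ∀ q : ℝ[X], IntegrableOn (fun x => M x * q.eval x) (Set.Ioi Y)) (ha : a ≠ 0) :
    a.degree ≤ b.degree ∧ (a.degree = b.degree → b.leadingCoeff / a.leadingCoeff < 0) := by
  have hno : ∀ k : ℕ, ¬ ∀ᶠ x in Filter.atTop, 0 ≤ x * (s * (b.eval x / a.eval x)) + k := by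
    intro k hk
    refine not_integrableOn_mul_pow_of_logDeriv_ge hpos hd k hk ?_
    simpa using hint (X ^ k)
  constructor
  · by_contra! hlt
    have hdeg : (X * b).degree ≤ a.degree := by
      by_cases hb : b = 0
      · simp [hb]
      rw [degree_eq_natDegree (mul_ne_zero X_ne_zero hb), degree_eq_natDegree ha,
        natDegree_X_mul hb]
      rw [degree_eq_natDegree hb, degree_eq_natDegree ha] at hlt
      have : b.natDegree < a.natDegree := by exact_mod_cast hlt
      exact_mod_cast this
    obtain ⟨c, hc⟩ := (isBigO_atTop_of_degree_le _ _ hdeg).bound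
    obtain ⟨k, hk⟩ := exists_nat_ge (s * c)
    apply hno k
    filter_upwards [hc, eventually_atTop_not_isRoot _ ha] with x hx hax
    have hax' : 0 < |a.eval x| := abs_pos.2 hax
    simp only [eval_mul, eval_X, Real.norm_eq_abs] at hx
    have h1 : |x * b.eval x / a.eval x| ≤ c := by
      rw [abs_div, div_le_iff₀ hax']
      exact hx
    have h2 := (abs_le.1 h1).1
    have h3 : x * (s * (b.eval x / a.eval x)) = s * (x * b.eval x / a.eval x) := by ring
    rw [h3]
    nlinarith
  · intro hdeg
    by_contra! hge
    have hb : b ≠ 0 := by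
      rintro rfl
      rw [degree_zero, degree_eq_bot] at hdeg
      exact ha hdeg
    have hgt : 0 < b.leadingCoeff / a.leadingCoeff := lt_of_le_of_ne hge
      (div_ne_zero (leadingCoeff_ne_zero.2 hb) (leadingCoeff_ne_zero.2 ha)).symm
    have ht := div_tendsto_atTop_leadingCoeff_div_of_degree_eq b a hdeg.symm
    apply hno 0
    filter_upwards [ht.eventually (lt_mem_nhds hgt), Filter.eventually_gt_atTop 0] with x hx hx0
    have hx' : 0 < b.eval x / a.eval x := hx
    have : 0 ≤ x * (s * (b.eval x / a.eval x)) := by positivity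
    simpa using this

/-- The reflection x ↦ -x reduces to the other end and reverses the sign of the logarithmic
derivative. -/
theorem degree_le_of_moments_atBot {M : ℝ → ℝ} {Y s : ℝ} (hs : 0 < s) {a b : ℝ[X]}
    (hpos : ∀ x ∈ Set.Iio Y, 0 < M x)
    (hd : ∀ x ∈ Set.Iio Y, HasDerivAt M (s * (b.eval x / a.eval x) * M x) x)
    (hint : ∀ q : ℝ[X], IntegrableOn (fun x => M x * q.eval x) (Set.Iio Y)) (ha : a ≠ 0) :
    a.degree ≤ b.degree ∧ (a.degree = b.degree → 0 < b.leadingCoeff / a.leadingCoeff) := by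
  have hdegX : ∀ q : ℝ[X], (q.comp (-X)).natDegree = q.natDegree := fun q => by
    simp [natDegree_comp]
  have hdeg : ∀ q : ℝ[X], (q.comp (-X)).degree = q.degree := by
    intro q
    by_cases hq : q = 0
    · simp [hq]
    have hq' : q.comp (-X) ≠ 0 := fun h => hq (by
      have := congrArg (fun f => f.comp (-X)) h
      simpa [comp_assoc] using this)
    rw [degree_eq_natDegree hq, degree_eq_natDegree hq', hdegX]
  have hlc : ∀ q : ℝ[X], (q.comp (-X)).leadingCoeff = q.leadingCoeff * (-1) ^ q.natDegree := by
    intro q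
    rw [leadingCoeff_comp (by simp)]
    simp
  have ha' : a.comp (-X) ≠ 0 := fun h => ha (by rw [← degree_eq_bot, ← hdeg, h, degree_zero])
  have hmem : ∀ {x : ℝ}, x ∈ Set.Ioi (-Y) → -x ∈ Set.Iio Y := fun hx => by
    simp only [Set.mem_Ioi, Set.mem_Iio] at hx ⊢
    linarith
  have hd' : ∀ x ∈ Set.Ioi (-Y), HasDerivAt (fun x => M (-x))
      (s * ((-(b.comp (-X))).eval x / (a.comp (-X)).eval x) * M (-x)) x := by
    intro x hx
    refine ((hd _ (hmem hx)).comp x (hasDerivAt_neg x)).congr_deriv ?_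
    simp
    ring
  have hint' : ∀ q : ℝ[X], IntegrableOn (fun x => M (-x) * q.eval x) (Set.Ioi (-Y)) := by
    intro q
    have := IntegrableOn.comp_neg_Ioi (c := -Y) (by simpa using hint (q.comp (-X)))
    simpa using this
  obtain ⟨h1, h2⟩ := degree_le_of_moments_atTop (M := fun x => M (-x)) hs
    (fun x hx => hpos _ (hmem hx)) hd' hint' ha'
  rw [degree_neg, hdeg, hdeg] at h1 h2
  refine ⟨h1, fun h => ?_⟩
  have h3 := h2 h
  rw [leadingCoeff_neg, hlc, hlc, natDegree_eq_of_degree_eq h, neg_div,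
    mul_div_mul_right _ _ (by simp)] at h3
  linarith

/-! ### The weight extended by zero to the real line. -/

theorem IsWeakSolution.indicator {I : Set ℝ} (hI : MeasurableSet I) {p : ℝ → ℝ} {n : ℕ}
    {a b c d : ℝ[X]} (h : IsWeakSolution I p n a b c d) :
    IsWeakSolution Set.univ (I.indicator p) n a b c d := by
  have e : ∀ f : ℝ → ℝ, (fun x => I.indicator p x * f x) = I.indicator (fun x => p x * f x) := by
    intro f
    ext x
    by_cases hx : x ∈ I <;> simp [hx]
  have e' : ∀ f : ℝ → ℝ, ∫ x in Set.univ, I.indicator p x * f x = ∫ x in I, p x * f x := by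
    intro f
    rw [setIntegral_univ, e, integral_indicator hI]
  refine ⟨fun q => ?_, fun u hu => ?_, fun u hu => ?_⟩
  · rw [integrableOn_univ, e fun x => q.eval x, integrable_indicator_iff hI]
    exact h.integrable q
  · exact (e' _).trans (h.first u hu)
  · exact (e' _).trans (h.third u hu)

theorem contDiff_eval (q : ℝ[X]) : ContDiff ℝ ∞ fun x => q.eval x := by
  simpa using q.contDiff_aeval (𝕜 := ℝ) ∞

section

variable {P : ℝ → ℝ} {n : ℕ} {a b c d : ℝ[X]}

theorem IsWeakSolution.integrable_mul_eval (h : IsWeakSolution Set.univ P n a b c d) (q : ℝ[X]) :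
    Integrable fun x => P x * q.eval x :=
  integrableOn_univ.1 (h.integrable q)

theorem IsWeakSolution.first_bump (h : IsWeakSolution Set.univ P n a b c d) (u : ℝ → ℝ)
    (hu : ContDiff ℝ ∞ u) (hc : HasCompactSupport u) :
    ∫ x, P x * (n * a.eval x * deriv u x + 2 * b.eval x * u x) = 0 := by
  rw [← setIntegral_univ]
  exact h.first u (bump_mem_testAlgebra hu hc)

/-- On an interval where `b / a = v / u` with `u` nonvanishing, `a P` is a multiple of a positive
solution of `M' = (2/n) (v/u) M`. -/
theorem IsWeakSolution.exists_solution (h : IsWeakSolution Set.univ P n a b c d) (hn : n ≠ 0)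
    {J : Set ℝ} (hJo : IsOpen J) (hJ : J.OrdConnected) {u v : ℝ[X]}
    (hu : ∀ x ∈ J, u.eval x ≠ 0) (huv : a * v = b * u) :
    ∃ (M : ℝ → ℝ) (K : ℝ), (∀ x, 0 < M x) ∧
      (∀ x ∈ J, HasDerivAt M (2 / n * (v.eval x / u.eval x) * M x) x) ∧
      ∀ᵐ x, x ∈ J → P x * a.eval x = K * M x := by
  have hn' : (n : ℝ) ≠ 0 := by exact_mod_cast hn
  obtain ⟨M, hMs, hMpos, hMd⟩ := exists_pos_solution hJo hJ
    (h := fun x => 2 / n * (v.eval x / u.eval x))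
    (contDiffOn_const.mul ((contDiff_eval v).contDiffOn.div (contDiff_eval u).contDiffOn hu))
  obtain ⟨K, hK⟩ := exists_ae_mul_eq_const_mul h.integrable_mul_eval h.first_bump hJo hJ hn hMs
    (fun x _ => (hMpos x).ne') hMd (fun x hx => by
      have h1 : a.eval x * v.eval x = b.eval x * u.eval x := by
        rw [← eval_mul, huv, eval_mul]
      have h2 := hu x hx
      field_simp
      linear_combination M x * h1)
  exact ⟨M, K, hMpos, hMd, hK⟩

theorem IsWeakSolution.integrableOn_solution (h : IsWeakSolution Set.univ P n a b c d)
    {J : Set ℝ} (hJ : MeasurableSet J) {M : ℝ → ℝ} {K : ℝ} (hK0 : K ≠ 0)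
    (hK : ∀ᵐ x, x ∈ J → P x * a.eval x = K * M x) (q : ℝ[X]) :
    IntegrableOn (fun x => M x * q.eval x) J := by
  have h1 := ((h.integrable_mul_eval (a * q)).const_mul K⁻¹).integrableOn (s := J)
  refine h1.congr ((ae_restrict_iff' hJ).2 ?_)
  filter_upwards [hK] with x hx hxJ
  rw [eval_mul, ← mul_assoc (P x), hx hxJ]
  field_simp

theorem ae_eq_zero_of_mul_eval {J : Set ℝ} (ha : a ≠ 0)
    (h : ∀ᵐ x, x ∈ J → P x * a.eval x = 0) : ∀ᵐ x, x ∈ J → P x = 0 := by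
  filter_upwards [h, ae_eval_ne_zero ha] with x hx hax hxJ
  exact (mul_eq_zero.1 (hx hxJ)).resolve_right hax

/-- The solution lives on all of ℝ, and with equal degrees the two infinities would demand opposite
signs of the leading ratio. -/
theorem IsWeakSolution.natDegree_lt_of_no_root (h : IsWeakSolution Set.univ P n a b c d)
    (hn : n ≠ 0) (hP : ¬ ∀ᵐ x, P x = 0) (ha : ∀ x, a.eval x ≠ 0) :
    a.natDegree < b.natDegree := by
  have ha0 : a ≠ 0 := by
    rintro rfl
    simp at ha
  have hs : (0 : ℝ) < 2 / n := by positivity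
  obtain ⟨M, K, hM, hd, hK⟩ := h.exists_solution hn isOpen_univ Set.ordConnected_univ
    (u := a) (v := b) (fun x _ => ha x) (mul_comm _ _)
  have hK0 : K ≠ 0 := by
    rintro rfl
    apply hP
    filter_upwards [ae_eq_zero_of_mul_eval ha0 (by simpa only [zero_mul] using hK)] with x hx
    exact hx trivial
  have hint := h.integrableOn_solution MeasurableSet.univ hK0 hK
  obtain ⟨h1, h2⟩ := degree_le_of_moments_atTop (Y := 0) hs (fun x _ => hM x)
    (fun x _ => hd x trivial) (fun q => (hint q).mono_set (Set.subset_univ _)) ha0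
  obtain ⟨-, h3⟩ := degree_le_of_moments_atBot (Y := 0) hs (fun x _ => hM x)
    (fun x _ => hd x trivial) (fun q => (hint q).mono_set (Set.subset_univ _)) ha0
  refine natDegree_lt_natDegree ha0 (lt_of_le_of_ne h1 fun he => ?_)
  linarith [h2 he, h3 he]

theorem IsWeakSolution.degree_le_of_unique_root (h : IsWeakSolution Set.univ P n a b c d)
    (hn : n ≠ 0) (hP : ¬ ∀ᵐ x, P x = 0) (ha0 : a ≠ 0) {r : ℝ} (ha : ∀ x, x ≠ r → a.eval x ≠ 0) :
    a.degree ≤ b.degree := by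
  have hs : (0 : ℝ) < 2 / n := by positivity
  obtain ⟨M, K, hM, hd, hK⟩ := h.exists_solution hn isOpen_Ioi (Set.ordConnected_Ioi (a := r))
    (u := a) (v := b) (fun x hx => ha x (ne_of_gt hx)) (mul_comm _ _)
  obtain ⟨M', K', hM', hd', hK'⟩ := h.exists_solution hn isOpen_Iio (Set.ordConnected_Iio (a := r))
    (u := a) (v := b) (fun x hx => ha x (ne_of_lt hx)) (mul_comm _ _)
  by_cases hK0 : K = 0
  · by_cases hK0' : K' = 0
    · exfalso
      apply hP
      subst hK0 hK0'
      filter_upwards [ae_eq_zero_of_mul_eval ha0 (by simpa only [zero_mul] using hK),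
        ae_eq_zero_of_mul_eval ha0 (by simpa only [zero_mul] using hK'),
        Measure.ae_ne volume r] with x h1 h2 h3
      rcases lt_or_gt_of_ne h3 with h4 | h4
      · exact h2 h4
      · exact h1 h4
    · exact (degree_le_of_moments_atBot hs (fun x _ => hM' x) hd'
        (h.integrableOn_solution measurableSet_Iio hK0' hK') ha0).1
  · exact (degree_le_of_moments_atTop hs (fun x _ => hM x) hd
      (h.integrableOn_solution measurableSet_Ioi hK0 hK) ha0).1

theorem eq_zero_of_ae_eq_mul {J : Set ℝ} (hJ : volume J ≠ 0) {f : ℝ → ℝ} {K : ℝ}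
    (hf : ∀ᵐ x, x ∈ J → f x ≠ 0) (h : ∀ᵐ x, x ∈ J → 0 = K * f x) : K = 0 := by
  by_contra hK
  apply hJ
  rw [measure_eq_zero_iff_ae_notMem]
  filter_upwards [hf, h] with x h1 h2 h3
  exact (mul_ne_zero hK (h1 h3)) (h2 h3).symm

/-- Otherwise b/a is regular at r, so a single constant K serves on all of ℝ; vanishing of P on J
makes it zero. -/
theorem IsWeakSolution.not_pow_dvd (h : IsWeakSolution Set.univ P n a b c d)
    (hn : n ≠ 0) (hP : ¬ ∀ᵐ x, P x = 0) (ha0 : a ≠ 0) {r : ℝ}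
    (ha : ∀ x, x ≠ r → a.eval x ≠ 0) {J : Set ℝ} (hJ : volume J ≠ 0)
    (hJP : ∀ x ∈ J, P x = 0) : ¬ (X - C r) ^ a.rootMultiplicity r ∣ b := by
  rintro ⟨v, hv⟩
  obtain ⟨u, hu, hur⟩ := exists_eq_pow_rootMultiplicity_mul_and_not_dvd a ha0 r
  have hu0 : ∀ x ∈ Set.univ, u.eval x ≠ 0 := by
    intro x _ hx
    by_cases hxr : x = r
    · subst hxr
      exact hur (dvd_iff_isRoot.2 hx)
    · apply ha x hxr
      rw [hu, eval_mul, hx, mul_zero]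
  have huv : a * v = b * u := by
    generalize a.rootMultiplicity r = m at hu hv
    rw [hu, hv]; ring
  obtain ⟨M, K, hM, hd, hK⟩ := h.exists_solution hn isOpen_univ Set.ordConnected_univ hu0 huv
  have hK0 : K = 0 := by
    refine eq_zero_of_ae_eq_mul hJ (f := M)
      (Filter.Eventually.of_forall fun x _ => (hM x).ne') ?_
    filter_upwards [hK] with x hx hxJ
    rw [← hx trivial, hJP x hxJ, zero_mul]
  subst hK0
  apply hP
  filter_upwards [ae_eq_zero_of_mul_eval ha0 (by simpa only [zero_mul] using hK)] with x hx
  exact hx trivial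

/-! ### Exclusion of a simple root not shared with b. -/

/-- The boundary term of the third order equation at a simple root `r` of `a`, for a density which
is a multiple of `S E` with `E' = (w/u) E` on each side of `r` and vanishes on one side. -/
theorem IsWeakSolution.boundary_term_eq_zero (h : IsWeakSolution Set.univ P n a b c d)
    (hn : n ≠ 0) (hP : ¬ ∀ᵐ x, P x = 0) {r : ℝ}
    (ha : ∀ x, x ≠ r → a.eval x ≠ 0) {u w S N : ℝ[X]} (hu : ∀ x, u.eval x ≠ 0)
    (hS : ∀ x, x ≠ r → S.eval x ≠ 0)
    (hJP : (∀ x ∈ Set.Ioi r, P x = 0) ∨ ∀ x ∈ Set.Iio r, P x = 0)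
    (h1 : derivative S * a * u + S * derivative a * u + S * a * w = C (2 / (n : ℝ)) * b * S * u)
    (h2 : C (((n : ℝ) - 1) / 6) * b * (S * w + derivative S * u) +
      S * C (((n : ℝ) - 1) / 6) * derivative b * u + N = S * c * u)
    (h3 : u * derivative N + (w - derivative u) * N = C (2 / ((n : ℝ) - 2)) * d * S * u ^ 2)
    {φ : ℝ → ℝ} (hφ : ContDiff ℝ ∞ φ) (hφc : HasCompactSupport φ) :
    S.eval r * (((n : ℝ) - 1) / 6) * b.eval r * deriv φ r * u.eval r + N.eval r * φ r = 0 := by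
  have hn' : (n : ℝ) ≠ 0 := by exact_mod_cast hn
  obtain ⟨E, hEs, hE, hEd⟩ := exists_pos_solution isOpen_univ Set.ordConnected_univ
    (h := fun x => w.eval x / u.eval x)
    ((contDiff_eval w).contDiffOn.div (contDiff_eval u).contDiffOn fun x _ => hu x)
  have hEs' : ContDiff ℝ ∞ E := contDiffOn_univ.1 hEs
  have hφ' : ContDiff ℝ ∞ (deriv φ) := (contDiff_infty_iff_deriv.1 hφ).2
  set κ := ((n : ℝ) - 1) / 6 with hκ
  have side : ∀ J : Set ℝ, IsOpen J → J.OrdConnected → r ∉ J →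
      ∃ K : ℝ, ∀ᵐ x, x ∈ J → P x = K * (S.eval x * E x) := by
    intro J hJo hJ hrJ
    have hne : ∀ x ∈ J, x ≠ r := fun x hx he => hrJ (he ▸ hx)
    -- By `h1`, S a E is a classical solution of n a M' = 2 b M.
    obtain ⟨K, hK⟩ := exists_ae_mul_eq_const_mul h.integrable_mul_eval h.first_bump hJo hJ hn
      (M := fun x => S.eval x * a.eval x * E x)
      (M' := fun x => ((derivative S).eval x * a.eval x + S.eval x * (derivative a).eval x) * E x +
        S.eval x * a.eval x * (w.eval x / u.eval x * E x))
      (((contDiff_eval S).mul (contDiff_eval a)).mul hEs').contDiffOn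
      (fun x hx => mul_ne_zero (mul_ne_zero (hS x (hne x hx)) (ha x (hne x hx))) (hE x).ne')
      (fun x _ => ((S.hasDerivAt x).fun_mul (a.hasDerivAt x)).fun_mul (hEd x trivial))
      (fun x _ => by
        have e := congrArg (eval x) h1
        simp only [eval_add, eval_mul, eval_C] at e
        have := hu x
        have e' : (derivative S).eval x * a.eval x + S.eval x * (derivative a).eval x +
            S.eval x * a.eval x * (w.eval x / u.eval x) = 2 / n * b.eval x * S.eval x := by
          field_simp
          field_simp at e
          linear_combination e
        calc _ = n * a.eval x * ((derivative S).eval x * a.eval x +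
              S.eval x * (derivative a).eval x +
              S.eval x * a.eval x * (w.eval x / u.eval x)) * E x := by ring
          _ = _ := by rw [e']; field_simp)
    refine ⟨K, ?_⟩
    filter_upwards [hK] with x hx hxJ
    have h5 := ha x (hne x hxJ)
    apply mul_right_cancel₀ h5
    rw [hx hxJ]
    ring
  obtain ⟨K₁, hK₁⟩ := side (Set.Ioi r) isOpen_Ioi Set.ordConnected_Ioi (by simp)
  obtain ⟨K₂, hK₂⟩ := side (Set.Iio r) isOpen_Iio Set.ordConnected_Iio (by simp)
  have hSE : ∀ J : Set ℝ, ∀ᵐ x, x ∈ J → S.eval x * E x ≠ 0 := by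
    intro J
    filter_upwards [Measure.ae_ne volume r] with x hx _
    exact mul_ne_zero (hS x hx) (hE x).ne'
  -- One of the constants is zero because P vanishes on that side; equality would make P vanish on
  -- both.
  have hKne : K₂ - K₁ ≠ 0 := by
    intro he
    have he' : K₂ = K₁ := by linarith
    have hz : K₁ = 0 := by
      rcases hJP with hz | hz
      · refine eq_zero_of_ae_eq_mul (J := Set.Ioi r) (by simp) (hSE _) ?_
        filter_upwards [hK₁] with x hx hxJ
        rw [← hx hxJ, hz x hxJ]
      · rw [← he']
        refine eq_zero_of_ae_eq_mul (J := Set.Iio r) (by simp) (hSE _) ?_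
        filter_upwards [hK₂] with x hx hxJ
        rw [← hx hxJ, hz x hxJ]
    apply hP
    filter_upwards [hK₁, hK₂, Measure.ae_ne volume r] with x e1 e2 e3
    rw [he'] at e2
    rw [hz, zero_mul] at e1 e2
    rcases lt_or_gt_of_ne e3 with e4 | e4
    · exact e2 e4
    · exact e1 e4
  -- An antiderivative of S E times the third order integrand: `h2` and `h3` match the coefficients
  -- of φ' and φ. Here N/u plays the role of Sγ. Integrating on both sides of r leaves (K₂ - K₁)
  -- F(r) = 0.
  set F : ℝ → ℝ := fun x => E x * (S.eval x * κ * b.eval x * deriv φ x +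
    N.eval x / u.eval x * φ x) with hF
  have hFs : ContDiff ℝ ∞ F := hEs'.mul (((((contDiff_eval S).mul contDiff_const).mul
    (contDiff_eval b)).mul hφ').add (((contDiff_eval N).div (contDiff_eval u) hu).mul hφ))
  have hFc : HasCompactSupport F :=
    HasCompactSupport.mul_left ((hφc.deriv.mul_left).add hφc.mul_left)
  have hFd : ∀ x, deriv F x = S.eval x * E x * (κ * b.eval x * deriv (deriv φ) x +
      c.eval x * deriv φ x + 2 / ((n : ℝ) - 2) * d.eval x * φ x) := by
    intro x
    have d1 := (hφ.differentiable (by simp) x).hasDerivAt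
    have d2 := (hφ'.differentiable (by simp) x).hasDerivAt
    have dF := (hEd x trivial).fun_mul
      (((((S.hasDerivAt x).mul_const κ).fun_mul (b.hasDerivAt x)).fun_mul d2).fun_add
        (((N.hasDerivAt x).fun_div (u.hasDerivAt x) (hu x)).fun_mul d1))
    refine dF.deriv.trans ?_
    have e2 := congrArg (eval x) h2
    have e3 := congrArg (eval x) h3
    simp only [eval_add, eval_mul, eval_C, eval_sub, eval_pow] at e2 e3
    have := hu x
    generalize 2 / ((n : ℝ) - 2) = δ at e3 ⊢
    field_simp
    linear_combination E x * (u.eval x * deriv φ x) * e2 + E x * φ x * e3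
  have hthird : ∫ x, P x * (κ * b.eval x * deriv (deriv φ) x + c.eval x * deriv φ x +
      2 / ((n : ℝ) - 2) * d.eval x * φ x) = 0 := by
    rw [← setIntegral_univ]
    exact h.third φ (bump_mem_testAlgebra hφ hφc)
  set G : ℝ → ℝ := fun x => κ * b.eval x * deriv (deriv φ) x + c.eval x * deriv φ x +
      2 / ((n : ℝ) - 2) * d.eval x * φ x with hG
  have t1 : ∫ x in Set.Ioi r, P x * G x = K₁ * -F r := by
    rw [← hFc.integral_Ioi_deriv_eq (hFs.of_le (by simp)) r, ← integral_const_mul]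
    refine setIntegral_congr_ae measurableSet_Ioi ?_
    filter_upwards [hK₁] with x hx hxJ
    rw [hx hxJ, hFd, hG]
    ring
  have t2 : ∫ x in Set.Iic r, P x * G x = K₂ * F r := by
    rw [← hFc.integral_Iic_deriv_eq (hFs.of_le (by simp)) r, ← integral_const_mul]
    refine setIntegral_congr_ae measurableSet_Iic ?_
    filter_upwards [hK₂, Measure.ae_ne volume r] with x hx hxr hxJ
    rw [hx (lt_of_le_of_ne hxJ hxr), hFd, hG]
    ring
  have hPG : Integrable fun x => P x * G x := by
    refine integrableOn_univ.1 (integrableOn_weight_mul h.integrable (u := G) ?_)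
    have hmem := bump_mem_testAlgebra hφ hφc
    have hX : ∀ (q : ℝ[X]) {f}, f ∈ testAlgebra → (fun x => q.eval x * f x) ∈ testAlgebra :=
      fun q f hf => Subalgebra.mul_mem _ (eval_mem_testAlgebra q) hf
    have := Subalgebra.add_mem _ (Subalgebra.add_mem _
      (hX (C κ * b) (deriv_mem_testAlgebra (deriv_mem_testAlgebra hmem)))
      (hX c (deriv_mem_testAlgebra hmem))) (hX (C (2 / ((n : ℝ) - 2)) * d) hmem)
    convert this using 1
    ext x
    simp [hG]
  have hsum : K₂ * F r + K₁ * -F r = 0 := by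
    rw [← t1, ← t2, ← hthird, ← Set.compl_Iic, integral_add_compl measurableSet_Iic hPG]
  have hFr : F r = 0 := by
    have : (K₂ - K₁) * F r = 0 := by linarith
    exact (mul_eq_zero.1 this).resolve_left hKne
  have := (mul_eq_zero.1 hFr).resolve_left (hE r).ne'
  have hur := hu r
  field_simp at this
  linear_combination this

theorem IsWeakSolution.eval_eq_zero_of_simple_root (h : IsWeakSolution Set.univ P n a b c d)
    (hflux : IsFluxRelation n a b c d)
    (hn : 4 ≤ n) (hP : ¬ ∀ᵐ x, P x = 0) {r : ℝ} {u : ℝ[X]} (hau : a = (X - C r) * u)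
    (hu : ∀ x, u.eval x ≠ 0)
    (hJP : (∀ x ∈ Set.Ioi r, P x = 0) ∨ ∀ x ∈ Set.Iio r, P x = 0) : b.eval r = 0 := by
  by_contra hb
  have hn4 : (4 : ℝ) ≤ n := by exact_mod_cast hn
  have hn0 : n ≠ 0 := by omega
  have hκ : ((n : ℝ) - 1) / 6 ≠ 0 := by
    apply ne_of_gt
    linarith
  have hXr : (X - C r : ℝ[X]) ≠ 0 := X_sub_C_ne_zero r
  have hu0 : u ≠ 0 := by
    rintro rfl
    simp at hu
  have ha0 : a ≠ 0 := hau ▸ mul_ne_zero hXr hu0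
  have har : a.eval r = 0 := by simp [hau]
  have ha : ∀ x, x ≠ r → a.eval x ≠ 0 := by
    intro x hx
    rw [hau, eval_mul]
    exact mul_ne_zero (by simpa using sub_ne_zero.2 hx) (hu x)
  have hda : derivative a = u + (X - C r) * derivative u := by
    rw [hau, derivative_mul]
    simp
  have hdar : (derivative a).eval r = u.eval r := by simp [hda]
  obtain ⟨B, hB, -⟩ : ∃ B : ContDiffBump r, B.rIn = 1 ∧ B.rOut = 2 :=
    ⟨⟨1, 2, by norm_num, by norm_num⟩, rfl, rfl⟩
  have hB1 : B r = 1 := B.one_of_mem_closedBall (by simp [hB])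
  have hBd : HasDerivAt B (deriv B r) r :=
    ((B.contDiff (n := 1)).differentiable one_ne_zero r).hasDerivAt
  have hQr : (fluxPoly n a b c).eval r =
      -(((n : ℝ) - 1) / 6) * ((2 / n * b.eval r - (derivative a).eval r) * b.eval r) := by
    simp only [fluxPoly, eval_sub, eval_mul, eval_add, eval_C, har]
    ring
  have hQe : fluxPoly n a b c = a * c - C (((n : ℝ) - 1) / 6) *
    (a * derivative b + (C (2 / (n : ℝ)) * b - derivative a) * b) := rfl
  have hfl : a * derivative (fluxPoly n a b c) +
    (C (2 / (n : ℝ)) * b - 2 * derivative a) * fluxPoly n a b c =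
      C (2 / ((n : ℝ) - 2)) * d * a ^ 2 := hflux
  generalize fluxPoly n a b c = Q at hQr hQe hfl
  rcases hflux.eval_cases hn har hb with h0 | h0
  -- Exponent 0: p is a multiple of E on each side, so S = 1. A test function with φ(r) = 0 and
  -- φ'(r) = 1 isolates the term in b(r).
  · obtain ⟨w, hw⟩ : (X - C r) ∣ C (2 / (n : ℝ)) * b - derivative a := by
      rw [dvd_iff_isRoot, IsRoot.def]
      simpa using h0
    obtain ⟨N, hN⟩ : (X - C r) ∣ Q := by
      rw [dvd_iff_isRoot, IsRoot.def, hQr, h0]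
      ring
    have h3 : (X - C r) ^ 2 * (u * derivative N + (w - derivative u) * N) =
        (X - C r) ^ 2 * (C (2 / ((n : ℝ) - 2)) * d * 1 * u ^ 2) := by
      have hdQ : derivative Q = N + (X - C r) * derivative N := by
        rw [hN, derivative_mul]
        simp
      rw [hdQ] at hfl
      have hb' : C (2 / (n : ℝ)) * b = (X - C r) * w + (u + (X - C r) * derivative u) := by
        rw [← hw, hda]; ring
      rw [hb', hda, hau, hN] at hfl
      linear_combination hfl
    have h2 : (X - C r) * (C (((n : ℝ) - 1) / 6) * b * (1 * w + derivative 1 * u) +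
        1 * C (((n : ℝ) - 1) / 6) * derivative b * u + N) = (X - C r) * (1 * c * u) := by
      rw [derivative_one]
      have : (X - C r) * N = Q := hN.symm
      rw [hQe, hw, hau] at this
      linear_combination this
    have h1 : derivative 1 * a * u + 1 * derivative a * u + 1 * a * w =
        C (2 / (n : ℝ)) * b * 1 * u := by
      rw [derivative_one]
      linear_combination w * hau - u * hw
    have hφ : HasDerivAt (fun x => (x - r) * B x) 1 r := by
      refine (((hasDerivAt_id r).sub_const r).fun_mul hBd).congr_deriv ?_
      simp [hB1]
    have := h.boundary_term_eq_zero hn0 hP ha hu (S := 1) (by simp) hJP h1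
      (mul_left_cancel₀ hXr h2) (mul_left_cancel₀ (pow_ne_zero 2 hXr) h3)
      (φ := fun x => (x - r) * B x) ((contDiff_id.sub contDiff_const).mul B.contDiff)
      B.hasCompactSupport.mul_left
    rw [hφ.deriv] at this
    simp only [eval_one, sub_self, zero_mul, mul_zero, add_zero, one_mul, mul_one] at this
    exact mul_ne_zero (mul_ne_zero hκ hb) (hu r) this
  -- Exponent 1: S = x - r kills the φ' term and N = Q. With φ(r) = 1 the boundary term is Q(r), a
  -- nonzero multiple of a'(r) b(r).
  · obtain ⟨w, hw⟩ : (X - C r) ∣ C (2 / (n : ℝ)) * b - derivative a - u := by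
      rw [dvd_iff_isRoot, IsRoot.def]
      simp only [eval_sub, eval_mul, eval_C]
      linarith
    have hdS : derivative (X - C r : ℝ[X]) = 1 := by simp
    have h3 : (X - C r) * (u * derivative Q + (w - derivative u) * Q) =
        (X - C r) * (C (2 / ((n : ℝ) - 2)) * d * (X - C r) * u ^ 2) := by
      have hb' : C (2 / (n : ℝ)) * b = (X - C r) * w + (u + (X - C r) * derivative u) + u := by
        rw [← hw, hda]; ring
      rw [hb', hda, hau] at hfl
      linear_combination hfl
    have h2 : C (((n : ℝ) - 1) / 6) * b * ((X - C r) * w + derivative (X - C r) * u) +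
        (X - C r) * C (((n : ℝ) - 1) / 6) * derivative b * u + Q = (X - C r) * c * u := by
      rw [hdS, hQe, ← hw, hau]
      ring
    have h1 : derivative (X - C r) * a * u + (X - C r) * derivative a * u + (X - C r) * a * w =
        C (2 / (n : ℝ)) * b * (X - C r) * u := by
      rw [hdS]
      linear_combination (u + (X - C r) * w) * hau - (X - C r) * u * hw
    have := h.boundary_term_eq_zero hn0 hP ha hu (S := X - C r)
      (fun x hx => by simpa using sub_ne_zero.2 hx) hJP h1 h2 (mul_left_cancel₀ hXr h3)
      (φ := B) B.contDiff B.hasCompactSupport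
    rw [hB1, hQr] at this
    have hur := hu r
    rw [hdar] at h0 this
    have h5 : (((n : ℝ) - 1) / 6) * (u.eval r * b.eval r) = 0 := by
      simp only [eval_sub, eval_X, eval_C, sub_self, zero_mul, zero_add, mul_one] at this
      linear_combination -this - (((n : ℝ) - 1) / 6) * b.eval r * h0
    exact mul_ne_zero hκ (mul_ne_zero hur hb) h5

end

/-! ### Parity of the order and conclusion. -/

theorem IsAdmissibleWeight.not_ae_eq_zero {I : Set ℝ} (hI : IsOpen I) {p : ℝ → ℝ}
    (hp : IsAdmissibleWeight I p) : ¬ ∀ᵐ x, x ∈ I → p x = 0 := by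
  obtain ⟨F, hF, hs, x₀, hx₀, hpos⟩ := hp.piecewise_smooth
  have hU : I \ F ∈ nhds x₀ := (hI.sdiff hF.isClosed).mem_nhds hx₀
  have hc : ContinuousAt p x₀ := hs.continuousOn.continuousAt hU
  intro h
  have h1 : {x | 0 < p x} ∩ (I \ F) ∈ nhds x₀ :=
    Filter.inter_mem (hc.eventually (lt_mem_nhds hpos)) hU
  refine (Measure.measure_pos_of_mem_nhds volume h1).ne' (measure_eq_zero_iff_ae_notMem.2 ?_)
  filter_upwards [h] with x hx hx'
  exact (ne_of_gt hx'.1) (hx hx'.2.1)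

/-- For odd n, multiplication by c n would be antisymmetric as well as symmetric, so ∫ p (c n)² = 0.
-/
theorem IsSignSymm.even {I : Set ℝ} (hI : MeasurableSet I) {p : ℝ → ℝ}
    (hp : ∀ q : ℝ[X], IntegrableOn (fun x => p x * q.eval x) I) (hnonneg : ∀ x ∈ I, 0 ≤ p x)
    (hnz : ¬ ∀ᵐ x, x ∈ I → p x = 0) {n : ℕ} {c : ℕ → ℝ[X]} (hc : c n ≠ 0)
    (h : IsSignSymm I p 1 c (n + 1)) : Even n := by
  by_contra hodd
  rw [Nat.not_even_iff_odd] at hodd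
  have h1 := (IsSignSymm.iterate hp n 1 (by rwa [add_comm 1 n])).integral_eq hp
    (eval_mem_testAlgebra (c n))
  apply hc
  refine eq_zero_of_integral_weight_mul_sq hI hp hnonneg hnz
    (integral_weight_mul_eq_zero_of_eq h1 (1 / 2) fun x => ?_)
  rw [hodd.neg_one_pow, polyDiffOp]
  simp
  ring

theorem Set.OrdConnected.disjoint_Ioi_or_Iio {I : Set ℝ} (hI : I.OrdConnected) {r : ℝ}
    (hr : r ∉ I) : (∀ x ∈ Set.Ioi r, x ∉ I) ∨ ∀ x ∈ Set.Iio r, x ∉ I := by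
  by_contra! h
  obtain ⟨⟨x, hx, hxI⟩, y, hy, hyI⟩ := h
  exact hr (hI.out hyI hxI ⟨le_of_lt hy, le_of_lt hx⟩)

theorem proposition3p6 (n : ℕ) (hn : 2 < n) (a : ℕ → ℝ[X])
    (hL : IsSelfAdjointDiffOp n a)
    (hroot : ∀ r s : ℝ, (a n).IsRoot r → (a n).IsRoot s → r = s) :
    (2 * ((a (n - 1)).natDegree : ℤ) - (a n).natDegree ≤ n - 2 ∨
      3 * ((a (n - 1)).natDegree : ℤ) - 2 * (a n).natDegree ≤ n - 3) ∧
    ((∀ r : ℝ, ¬ (a n).IsRoot r) →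
      (a n).natDegree < (a (n - 1)).natDegree ∧ ((a (n - 1)).natDegree : ℤ) ≤ n - 3) ∧
    (∀ r : ℝ, (a n).IsRoot r →
      (2 ≤ (a n).natDegree ∧ (a n).natDegree ≤ (a (n - 1)).natDegree ∧
        ((a (n - 1)).natDegree : ℤ) ≤ n - 2) ∧
      ∀ u v : ℝ[X],
        a n = (X - C r) ^ (a n).rootMultiplicity r * u →
        a (n - 1) = (X - C r) ^ (a (n - 1)).rootMultiplicity r * v →
          1 + u.natDegree ≤ v.natDegree ∧ (v.natDegree : ℤ) ≤ n - 3) := by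
  obtain ⟨ha0, hdeg, I, p, hIo, hIc, -, hIa, hp, hsymm⟩ := hL
  have hIm := hIo.measurableSet
  have hnz := hp.not_ae_eq_zero hIo
  have hS := isSignSymm_of_isTestFunction hp.integrable hsymm
  have hev : Even n := hS.even hIm hp.integrable hp.nonneg hnz (by
    rw [if_neg (by omega)]
    exact ha0)
  have hn4 : 4 ≤ n := by
    obtain ⟨k, hk⟩ := hev
    omega
  have hn0 : n ≠ 0 := by omega
  have hW := isWeakSolution_of_isSignSymm hp.integrable hn4 hev hS
  simp only [if_neg (show n ≠ 0 by omega), if_neg (show n - 1 ≠ 0 by omega),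
    if_neg (show n - 2 ≠ 0 by omega), if_neg (show n - 3 ≠ 0 by omega)] at hW
  have hflux := hW.isFluxRelation hIm hn0 hp.nonneg hnz
  have hb := hdeg (n - 1) (Finset.mem_Icc.2 ⟨by omega, by omega⟩)
  have hc := hdeg (n - 2) (Finset.mem_Icc.2 ⟨by omega, by omega⟩)
  have hd := hdeg (n - 3) (Finset.mem_Icc.2 ⟨by omega, by omega⟩)
  have hWl := hW.indicator hIm
  have hP : ¬ ∀ᵐ x, I.indicator p x = 0 := by
    intro h
    apply hnz
    filter_upwards [h] with x hx hxI
    rwa [Set.indicator_of_mem hxI] at hx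
  have hdisj : 2 * (a (n - 1)).natDegree ≤ n - 2 + (a n).natDegree ∨
      3 * (a (n - 1)).natDegree ≤ n - 3 + 2 * (a n).natDegree := by
    by_cases hab : (a n).natDegree ≤ (a (n - 1)).natDegree
    · by_cases hlt : n - 2 + (a n).natDegree < 2 * (a (n - 1)).natDegree
      · exact Or.inr (hflux.natDegree_le hn4 hc hd hab hlt)
      · exact Or.inl (by omega)
    -- For deg b < deg a the first alternative follows from deg b ≤ n - 1 alone.
    · exact Or.inl (by omega)
  refine ⟨by omega, fun hno => ?_, fun r hr => ?_⟩
  · have := hWl.natDegree_lt_of_no_root hn0 hP hno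
    omega
  have har : ∀ x, x ≠ r → (a n).eval x ≠ 0 := fun x hx h => hx (hroot x r h hr)
  have hdle := hWl.degree_le_of_unique_root hn0 hP ha0 har
  have hle := natDegree_le_natDegree hdle
  have hb0 : a (n - 1) ≠ 0 := by
    intro h
    rw [h, degree_zero, le_bot_iff, degree_eq_bot] at hdle
    exact ha0 hdle
  have hside : (∀ x ∈ Set.Ioi r, I.indicator p x = 0) ∨
      ∀ x ∈ Set.Iio r, I.indicator p x = 0 :=
    (hIc.disjoint_Ioi_or_Iio (fun h => hIa r h hr)).imp
      (fun h x hx => Set.indicator_of_notMem (h x hx) p)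
      (fun h x hx => Set.indicator_of_notMem (h x hx) p)
  -- The goal is 1 ≤ β < α, which gives α ≥ 2 and makes deg v - deg u exceed deg b - deg a.
  have hmult : (a (n - 1)).rootMultiplicity r < (a n).rootMultiplicity r := by
    by_contra! hge
    have hdvd : (X - C r) ^ (a n).rootMultiplicity r ∣ a (n - 1) :=
      (le_rootMultiplicity_iff hb0).1 hge
    rcases hside with h | h
    · exact hWl.not_pow_dvd hn0 hP ha0 har (J := Set.Ioi r) (by simp) h hdvd
    · exact hWl.not_pow_dvd hn0 hP ha0 har (J := Set.Iio r) (by simp) h hdvd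
  have hbr : (a (n - 1)).eval r = 0 := by
    by_cases hder : (derivative (a n)).eval r = 0
    · exact hflux.eval_eq_zero hn4 hr hder
    obtain ⟨u, hu⟩ := dvd_iff_isRoot.2 hr
    refine hWl.eval_eq_zero_of_simple_root hflux hn4 hP hu (fun x hx => ?_) hside
    by_cases hxr : x = r
    · subst hxr
      apply hder
      rw [hu, derivative_mul]
      simp [hx]
    · apply har x hxr
      rw [hu, eval_mul, hx, mul_zero]
  have hbm : 1 ≤ (a (n - 1)).rootMultiplicity r := (rootMultiplicity_pos hb0).2 hbr
  have hfac : ∀ {f q : ℝ[X]} {m : ℕ}, f ≠ 0 → f = (X - C r) ^ m * q →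
      f.natDegree = m + q.natDegree := by
    intro f q m hf he
    have hq : q ≠ 0 := by
      rintro rfl
      exact hf (by rw [he, mul_zero])
    rw [he, natDegree_mul (pow_ne_zero _ (X_sub_C_ne_zero r)) hq, natDegree_pow,
      natDegree_X_sub_C, mul_one]
  constructor
  · obtain ⟨u, hu, -⟩ := exists_eq_pow_rootMultiplicity_mul_and_not_dvd (a n) ha0 r
    have := hfac ha0 hu
    omega
  · intro u v hu hv
    have h1 := hfac ha0 hu
    have h2 := hfac hb0 hv
    omega
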